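/- Let $H\in(\tfrac13,1)$, $T>0$, and let $B=(B^1,\dots,B^K)$ be an $\mathbb R^K$-valued fractional Brownian motion with Hurst index $H$ on a probability space, i.e. a centred Gaussian process with $\mathbb E(B^i_tB^j_s)=\tfrac12\mathbf 1_{i=j}(t^{2H}+s^{2H}-|t-s|^{2H})$, $s,t\ge 0$. Below, $\alpha$ ranges over all exponents with $\tfrac13<\alpha<H$, and in addition $\alpha>\tfrac12$ if $H>\tfrac12$. For a path $x$ on $[0,T]$ write $\delta x_{st}=x_t-x_s$; for a two-parameter map $F$ let $[F]_{a}=\sup_{0\le s\le t\le T}|F_{st}|/|t-s|^{a}\in[0,\infty]$ (with $0/0=0$, and $x/0=\infty$ for $x\neq0$), and put $[x]_a=[\delta x]_a$ and $\|x\|_a=\|x\|_\infty+[x]_a$. Let $(B,\mathbb B)$ be a rough path lift of $B$: almost surely, for all $\alpha$, $[B]_\alpha<\infty$ and, if $H\le\tfrac12$, $\mathbb B$ is a map from $\{0\le s\le t\le T\}$ to $\mathbb R^{K\times K}$ with $[\mathbb B]_{2\alpha}<\infty$ and $\mathbb B^{l,k}_{st}=\mathbb B^{l,k}_{su}+\delta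 B^l_{su}\,\delta B^k_{ut}+\mathbb B^{l,k}_{ut}$ for $0\le s\le u\le t\le T$. Let $u:[0,T]\times\mathbb R^d\to\mathbb R^d$ be continuous, let $\sigma_1,\dots,\sigma_K:\mathbb R^d\to\mathbb R^d$ be of class $C^2$ if $H\le\frac12$ and $C^1$ if $H>\frac12$, and let $\theta_1,\dots,\theta_K\ge 0$. Let $y$ be a pathwise solution on $[0,T]$ of $$dy_t=u_t(y_t)\,dt+\sum_{k=1}^K\theta_k\sigma_k(y_t)\,d\mathbf B^k_t ,$$ i.e., with $V_k=\theta_k\sigma_k$ and $V_l[V_k]=\sum_jV_l^j\partial_jV_k$, almost surely, for all $\alpha$: $[y]_\alpha<\infty$; the map $y^\sharp_{st}=\delta y_{st}-\int_s^tu_r(y_r)\,dr-\sum_kV_k(y_s)\,\delta B^k_{st}$ satisfies $[y^\sharp]_{2\alpha}<\infty$; and, if $H\le\frac12$, the map $y^\natural_{st}=y^\sharp_{st}-\sum_{k,l}V_l[V_k](y_s)\,\mathbb B^{l,k}_{st}$ satisfies $[y^\natural]_{3\alpha}<\infty$. Let $t^n_i=iT2^{-n}$, $0\le i\le 2^n$,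 and for $x:[0,T]\to\mathbb R$, $\gamma\in\mathbb R$ put $$\langle x\rangle^{(\gamma),n}_T=\sum_{i=0}^{2^n-1}(t^n_{i+1}-t^n_i)^\gamma(x_{t^n_{i+1}}-x_{t^n_i})^2,\qquad \langle x\rangle^{(\gamma)}_T=\lim_{n\to\infty}\langle x\rangle^{(\gamma),n}_T .$$ The Hurst index is estimated by $$H_n=\tfrac12\Big(1-\frac{\ln S_n}{\ln 2}\Big),\qquad S_n=\frac{\sum_j\langle y^j\rangle_T^{(0),n+1}}{\sum_j\langle y^j\rangle_T^{(0),n}} .$$ Let $f_1,\dots,f_M\in C^2(\mathbb R^d)$, write $\sigma_k[f]=\sum_j\sigma_k^j\partial_jf$, and set $$Y^m=\langle f_m(y)\rangle_T^{(1-2H)},\quad X^{mk}=\int_0^T\sigma_k[f_m](y_r)^2\,dr,\quad \bar Y_n^m=\langle f_m(y)\rangle_T^{(1-2H_n),n},\quad X_n^{mk}=\sum_{i=0}^{2^n-1}\sigma_k[f_m](y_{t^n_i})^2\,(t^n_{i+1}-t^n_i).$$ Assume that, almost surely, the columns of $X$ are linearly independent and $Y\ne 0$. Let $\beta_k=\theta_k^2$,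 let $\bar\beta_n\in\operatorname{arg\,min}_{b\in\mathbb R^K}|\bar Y_n-X_nb|$ be any minimizer, and let $\bar\theta_{n,k}=\sqrt{\bar\beta_{n,k}}$ (with $\sqrt a:=0$ for $a<0$). Let $$\delta_n=2^{-n/2}\sqrt n\ \text{ if }H\le\tfrac12,\qquad \delta_n=2^{-n(1-H)}\sqrt n\ \text{ if }H>\tfrac12 .$$ Then for every $\epsilon>0$, almost surely, $$|\beta-\bar\beta_n|\le C_1\,n\,\delta_n^{H-\epsilon}\quad\text{for all sufficiently large } n,$$ and for every $k$ with $\beta_k>0$, $$|\theta_k-\bar\theta_{n,k}|\le (C_1\vee\beta_k^{-1})\,n\,\delta_n^{H-\epsilon}\quad\text{for all sufficiently large } n.$$ Here, how large $n$ must be may depend on the realization, and, for given $d,K,M,H,\epsilon$, $C_1$ is a function of $T$, of the condition number $\kappa(X)=\|X\|_2\|(X^TX)^{-1}X^T\|_2$ (Frobenius norms), of $\|B\|_{H-\epsilon}$, and of $\|f_m(y)'\|_{H-\epsilon}$, $[f_m(y)^\sharp]_{2(H-\epsilon)}$ and $[\sigma_k[f_m]^2(y)]_{H-\epsilon}$ for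 $1\le m\le M$, $1\le k\le K$, where $f_m(y)'=(\theta_k\sigma_k[f_m](y))_{1\le k\le K}$ and $f_m(y)^\sharp_{st}=\delta f_m(y)_{st}-\sum_k\theta_k\sigma_k[f_m](y_s)\,\delta B^k_{st}$. -/

import Mathlib

open MeasureTheory ProbabilityTheory Filter Topology Set
open scoped NNReal ENNReal Matrix

noncomputable section

namespace FracDiff

/-- Euclidean space `ℝ^d`. -/
abbrev E (d : ℕ) : Type := EuclideanSpace ℝ (Fin d)

/-! ### Hölder norms, rough paths and rough differential equations on `[0,T]` -/

/-- The `α`-Hölder seminorm `sup_{0 ≤ s ≤ t ≤ T} |F s t| / |t - s|^α ∈ [0,∞]` of a two-parameter map;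
in `ℝ≥0∞` one has `0 / 0 = 0` and `x / 0 = ∞` for `x ≠ 0`. -/
def holderSemi₂ {V : Type*} [NormedAddCommGroup V] (T α : ℝ) (F : ℝ → ℝ → V) : ℝ≥0∞ :=
  ⨆ s ∈ Icc (0 : ℝ) T, ⨆ t ∈ Icc s T, ‖F s t‖ₑ / ENNReal.ofReal ((t - s) ^ α)

/-- The `α`-Hölder seminorm on `[0,T]` of a path. -/
def holderSemi {V : Type*} [NormedAddCommGroup V] (T α : ℝ) (x : ℝ → V) : ℝ≥0∞ :=
  holderSemi₂ T α (fun s t => x t - x s)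

/-- The `α`-Hölder norm on `[0,T]` of a path: supremum norm plus `α`-Hölder seminorm. -/
def holderNorm {V : Type*} [NormedAddCommGroup V] (T α : ℝ) (x : ℝ → V) : ℝ≥0∞ :=
  (⨆ t ∈ Icc (0 : ℝ) T, ‖x t‖ₑ) + holderSemi T α x

/-- `(z, Z)` is an `α`-Hölder rough path over `[0,T]`. For `α > 1/2` this just means that `z` is
`α`-Hölder, and `Z` plays no role. -/
structure IsRoughPath {K : ℕ} (T α : ℝ) (z : ℝ → E K) (Z : ℝ → ℝ → Matrix (Fin K) (Fin K) ℝ) :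
    Prop where
  holder : holderSemi T α z < ∞
  holder₂ : α ≤ 1 / 2 → ∀ l k, holderSemi₂ T (2 * α) (fun s t => Z s t l k) < ∞
  chen : α ≤ 1 / 2 → ∀ s u t : ℝ, 0 ≤ s → s ≤ u → u ≤ t → t ≤ T → ∀ l k,
    Z s t l k = Z s u l k + (z u l - z s l) * (z t k - z u k) + Z u t l k

/-- The path `y` solves `dy = u_t(y) dt + ∑ k, V_k(y) dZ^k` on `[0,T]`, driven by the `α`-Hölder
rough path `(z, Z)` (by `z` alone if `α > 1/2`). Here `fderiv ℝ (V k) x (V l x)` is the vector field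
`V_l[V_k]` at `x`. -/
structure IsRDESolution {d K : ℕ} (T α : ℝ) (z : ℝ → E K) (Z : ℝ → ℝ → Matrix (Fin K) (Fin K) ℝ)
    (u : ℝ → E d → E d) (V : Fin K → E d → E d) (y : ℝ → E d) : Prop where
  holder : holderSemi T α y < ∞
  sharp : holderSemi₂ T (2 * α) (fun s t =>
    y t - y s - (∫ r in s..t, u r (y r)) - ∑ k, (z t k - z s k) • V k (y s)) < ∞
  natural : α ≤ 1 / 2 → holderSemi₂ T (3 * α) (fun s t =>
    y t - y s - (∫ r in s..t, u r (y r)) - ∑ k, (z t k - z s k) • V k (y s)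
      - ∑ k, ∑ l, Z s t l k • fderiv ℝ (V k) (y s) (V l (y s))) < ∞

/-! ### Fractional Brownian motion -/

/-- `B` (its restriction to times `t ≥ 0`) is an `ℝ^K`-valued fractional Brownian motion with Hurst
parameter `H`: a centred Gaussian process with the fractional covariance. -/
structure IsFBM {Ω : Type*} [MeasurableSpace Ω] (P : Measure Ω) {K : ℕ} (H : ℝ)
    (B : ℝ → Ω → E K) : Prop where
  gaussian : IsGaussianProcess (fun t : ℝ≥0 => B t) P
  centred : ∀ t : ℝ, 0 ≤ t → ∀ i, ∫ ω, B t ω i ∂P = 0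
  covariance : ∀ s t : ℝ, 0 ≤ s → 0 ≤ t → ∀ i j, ∫ ω, B t ω i * B s ω j ∂P =
    if i = j then (1 / 2) * (t ^ (2 * H) + s ^ (2 * H) - |t - s| ^ (2 * H)) else 0

/-! ### Scaled quadratic variation along dyadic partitions, and the estimators -/

/-- The point `i T 2^{-n}` of the `n`-th dyadic partition of `[0,T]`. -/
def dyadic (T : ℝ) (n i : ℕ) : ℝ := i * T / 2 ^ n

/-- `⟨x⟩_T^{(γ),n}`, along the `n`-th dyadic partition of `[0,T]`. -/
def scaledQVn (T γ : ℝ) (n : ℕ) (x : ℝ → ℝ) : ℝ :=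
  ∑ i ∈ Finset.range (2 ^ n), (dyadic T n (i + 1) - dyadic T n i) ^ γ *
    (x (dyadic T n (i + 1)) - x (dyadic T n i)) ^ 2

/-- `⟨x⟩_T^{(γ)} = lim_n ⟨x⟩_T^{(γ),n}`. -/
def scaledQV (T γ : ℝ) (x : ℝ → ℝ) : ℝ :=
  limUnder atTop (fun n => scaledQVn T γ n x)

/-- The vector-valued version `⟨⟨y⟩⟩_T^{(γ),n} = ∑ j, ⟨y^j⟩_T^{(γ),n}`. -/
def scaledQVnVec {d : ℕ} (T γ : ℝ) (n : ℕ) (y : ℝ → E d) : ℝ :=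
  ∑ j, scaledQVn T γ n (fun t => y t j)

/-- The estimator `H_n = (1 - ln S_n / ln 2) / 2`, `S_n = ⟨⟨y⟩⟩_T^{(0),n+1} / ⟨⟨y⟩⟩_T^{(0),n}`, of the
Hurst index. -/
def hurstEst {d : ℕ} (T : ℝ) (y : ℝ → E d) (n : ℕ) : ℝ :=
  (1 / 2) * (1 - Real.log (scaledQVnVec T 0 (n + 1) y / scaledQVnVec T 0 n y) / Real.log 2)

/-- The action `σ[f](x) = ∑ j, σ^j(x) ∂_j f(x)` of a vector field on a function. -/
def act {d : ℕ} (σ : E d → E d) (f : E d → ℝ) (x : E d) : ℝ := fderiv ℝ f x (σ x)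

/-- `Y^m = ⟨f_m(y)⟩_T^{(1-2H)}`. -/
def obsVec {d M : ℕ} (T H : ℝ) (f : Fin M → E d → ℝ) (y : ℝ → E d) : E M :=
  WithLp.toLp 2 fun m => scaledQV T (1 - 2 * H) (fun t => f m (y t))

/-- `X^{mk} = ∫_0^T σ_k[f_m]²(y_r) dr`. -/
def design {d K M : ℕ} (T : ℝ) (σ : Fin K → E d → E d) (f : Fin M → E d → ℝ) (y : ℝ → E d) :
    Matrix (Fin M) (Fin K) ℝ :=
  Matrix.of fun m k => ∫ r in (0 : ℝ)..T, act (σ k) (f m) (y r) ^ 2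

/-- `Ȳ_n^m = ⟨f_m(y)⟩_T^{(1-2H_n),n}`, with the estimated Hurst index `H_n`. -/
def obsVecEst {d M : ℕ} (T : ℝ) (f : Fin M → E d → ℝ) (y : ℝ → E d) (n : ℕ) : E M :=
  WithLp.toLp 2 fun m => scaledQVn T (1 - 2 * hurstEst T y n) n (fun t => f m (y t))

/-- `X_n^{mk}`, the left-point Riemann sum of `X^{mk}` along the `n`-th dyadic partition. -/
def designN {d K M : ℕ} (T : ℝ) (σ : Fin K → E d → E d) (f : Fin M → E d → ℝ) (y : ℝ → E d)
    (n : ℕ) : Matrix (Fin M) (Fin K) ℝ :=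
  Matrix.of fun m k => ∑ i ∈ Finset.range (2 ^ n),
    act (σ k) (f m) (y (dyadic T n i)) ^ 2 * (dyadic T n (i + 1) - dyadic T n i)

/-- `b ∈ argmin_b |Y - A b|` (Euclidean norm). -/
def IsLeastSquares {K M : ℕ} (A : Matrix (Fin M) (Fin K) ℝ) (Y : E M) (b : E K) : Prop :=
  ∀ b' : E K, ‖Y - WithLp.toLp 2 (A *ᵥ b.ofLp)‖ ≤ ‖Y - WithLp.toLp 2 (A *ᵥ b'.ofLp)‖

/-- The rate `δ_n`. -/
def rate (H : ℝ) (n : ℕ) : ℝ :=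
  if H ≤ 1 / 2 then (2 : ℝ) ^ (-(n : ℝ) / 2) * √(n : ℝ)
  else (2 : ℝ) ^ (-(n : ℝ) * (1 - H)) * √(n : ℝ)

/-! ### The quantities on which the constants may depend -/

/-- Frobenius norm of a matrix. -/
def frob {m n : ℕ} (A : Matrix (Fin m) (Fin n) ℝ) : ℝ := √(∑ i, ∑ j, A i j ^ 2)

/-- The condition number `‖A‖₂ ‖(AᵀA)⁻¹Aᵀ‖₂`. -/
def condNumber {m n : ℕ} (A : Matrix (Fin m) (Fin n) ℝ) : ℝ := frob A * frob ((Aᵀ * A)⁻¹ * Aᵀ)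

/-- The Gubinelli derivative `f(y)' = (V_1[f](y), …, V_K[f](y))` of `f(y)`. -/
def gubDeriv {d K : ℕ} (V : Fin K → E d → E d) (f : E d → ℝ) (y : ℝ → E d) (t : ℝ) : E K :=
  WithLp.toLp 2 fun k => act (V k) f (y t)

/-- The remainder `f(y)^♯_{st} = f(y_t) - f(y_s) - f(y)'_s (z_t - z_s)`. -/
def gubRem {d K : ℕ} (z : ℝ → E K) (V : Fin K → E d → E d) (f : E d → ℝ) (y : ℝ → E d)
    (s t : ℝ) : ℝ :=
  f (y t) - f (y s) - ∑ k, gubDeriv V f y s k * (z t k - z s k)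

end FracDiff

end

open FracDiff

/-! ### Moments of Gaussian random variables -/

section GaussianMoments

variable {Ω : Type*} [MeasurableSpace Ω] {P : Measure Ω}

/-! Write h = T / 2^n and r = `fluctExp H`. For a scalar fractional Brownian motion, Isserlis'
formula turns the variance of a sum of N centred squared increments into a sum of squared
covariances. Off the diagonal all covariances have the same sign, decided by whether x^(2H) is
convex or concave, so the sum of their absolute values follows from the variance of a sum alone.
After scaling, N consecutive terms deviate by at most 2 h N^(1-r) in L². A Hölder weight g is
handled by cutting the grid into about 2^(rn) blocks and freezing g on each. The block sums have
summable means after multiplication by 2^(κn) for κ < rH, hence are almost surely O(2^(-κn));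
freezing costs about 2^(-ran) for an a-Hölder g (`IsScalarFBM.ae_blockSum_le`,
`weighted_sum_isBigO`). Polarisation gives the covariations of different components
(`FracDiff.IsFBM.ae_hasQVRate`). By Taylor expansion a C² function of the solution is controlled by
B, with a remainder of order min(2a, 1). Its scaled quadratic variation is therefore a Riemann sum
of the θ_k² σ_k[f]², up to O(2^(-κn)) (`scaledQVn_sub_riemannSum_isBigO`): the observations are X_n
β plus a small error. Replacing H by H_n, which is accurate to O(2^(-κn)), costs a factor n because
log h is of order n, and injectivity of X carries the error over to the minimiser
(`leastSquares_sub_isBigO`). Finally κ can be taken so close to rH that n 2^(-κn) is little-o of the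
claimed rate (`exists_exponents`, `isLittleO_rate`). -/

theorem iteratedDeriv_four_exp_mul_sq_zero (v : ℝ) :
    iteratedDeriv 4 (fun t : ℝ => Real.exp (v * t ^ 2 / 2)) 0 = 3 * v ^ 2 := by
  have hE (t : ℝ) : HasDerivAt (fun t : ℝ => Real.exp (v * t ^ 2 / 2))
      (Real.exp (v * t ^ 2 / 2) * (v * t)) t := by
    have := (((hasDerivAt_pow 2 t).const_mul v).div_const 2).exp
    convert this using 1
    simp; ring
  have hP (p p' : ℝ → ℝ) (hp : ∀ t, HasDerivAt p (p' t) t) :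
      deriv (fun t => p t * Real.exp (v * t ^ 2 / 2)) =
        fun t => (p' t + v * t * p t) * Real.exp (v * t ^ 2 / 2) := by
    funext t
    refine (((hp t).mul (hE t)).congr_deriv ?_).deriv
    ring
  have h1 : deriv (fun t : ℝ => Real.exp (v * t ^ 2 / 2)) =
      fun t => (v * t) * Real.exp (v * t ^ 2 / 2) := by
    funext t; rw [(hE t).deriv]; ring
  have h2 := hP (fun t => v * t) (fun _ => v) (fun t => by simpa using (hasDerivAt_id t).const_mul v)
  have h3 := hP (fun t => v + v * t * (v * t)) (fun t => v ^ 2 * (2 * t)) (fun t => by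
    have h := (hasDerivAt_id' t).const_mul v
    refine ((h.mul h).const_add v).congr_deriv ?_
    ring)
  have h4 := hP (fun t => v ^ 2 * (2 * t) + v * t * (v + v * t * (v * t)))
    (fun t => 3 * v ^ 2 + v ^ 3 * (3 * t ^ 2)) (fun t => by
    have h := (hasDerivAt_id' t).const_mul v
    refine ((((hasDerivAt_id' t).const_mul 2).const_mul (v ^ 2)).add
      (h.mul ((h.mul h).const_add v))).congr_deriv ?_
    simp only [Pi.mul_apply]
    ring)
  simp only [iteratedDeriv_succ, iteratedDeriv_zero]
  rw [h1, h2, h3, h4]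
  simp

theorem ProbabilityTheory.HasGaussianLaw.integrable_pow {X : Ω → ℝ} (hX : HasGaussianLaw X P)
    (n : ℕ) : Integrable (fun ω => X ω ^ n) P := by
  have := hX.isProbabilityMeasure
  have h := (hX.memLp (p := n) (by simp)).integrable_norm_pow'
  refine h.mono' (hX.aemeasurable.pow_const n).aestronglyMeasurable ?_
  filter_upwards with ω
  simp

/-- The fourth moment is the fourth derivative at 0 of the moment generating function exp(v t² / 2);
this includes the degenerate case v = 0. -/
theorem ProbabilityTheory.HasGaussianLaw.integral_pow_four {X : Ω → ℝ} (hX : HasGaussianLaw X P)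
    (h0 : ∫ ω, X ω ∂P = 0) : ∫ ω, X ω ^ 4 ∂P = 3 * (∫ ω, X ω ^ 2 ∂P) ^ 2 := by
  have := hX.isProbabilityMeasure
  have hmap := hX.map_eq_gaussianReal
  rw [h0] at hmap
  have hvar : Var[X; P] = ∫ ω, X ω ^ 2 ∂P := by
    rw [variance_of_integral_eq_zero hX.aemeasurable h0]
  rw [hvar] at hmap
  have hv : 0 ≤ ∫ ω, X ω ^ 2 ∂P := integral_nonneg fun ω => sq_nonneg _
  set v := ∫ ω, X ω ^ 2 ∂P
  have e1 : ∫ ω, X ω ^ 4 ∂P = ∫ x, x ^ 4 ∂(P.map X) :=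
    (integral_map hX.aemeasurable (f := fun x : ℝ => x ^ 4) (by fun_prop)).symm
  have e2 := iteratedDeriv_mgf_zero (X := id) (μ := gaussianReal 0 v.toNNReal)
    (by rw [integrableExpSet_id_gaussianReal]; simp) 4
  rw [e1, hmap]
  have e3 : mgf id (gaussianReal 0 v.toNNReal) = fun t : ℝ => Real.exp (v * t ^ 2 / 2) := by
    rw [mgf_id_gaussianReal]
    funext t
    simp [Real.coe_toNNReal _ hv]
  rw [e3, iteratedDeriv_four_exp_mul_sq_zero] at e2
  rw [e2]
  rfl

variable {U V : Ω → ℝ}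

theorem integrable_mul_of_hasGaussianLaw (hp : HasGaussianLaw (fun ω => U ω + V ω) P)
    (hm : HasGaussianLaw (fun ω => U ω - V ω) P) : Integrable (fun ω => U ω * V ω) P := by
  have := ((HasGaussianLaw.integrable_pow hp 2).sub (HasGaussianLaw.integrable_pow hm 2)).div_const 4
  refine this.congr (ae_of_all _ fun ω => ?_)
  simp only [Pi.sub_apply]
  ring

theorem integrable_sq_mul_sq_of_hasGaussianLaw (hU : HasGaussianLaw U P) (hV : HasGaussianLaw V P)
    (hp : HasGaussianLaw (fun ω => U ω + V ω) P) (hm : HasGaussianLaw (fun ω => U ω - V ω) P) :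
    Integrable (fun ω => U ω ^ 2 * V ω ^ 2) P := by
  have := ((((HasGaussianLaw.integrable_pow hp 4).add (HasGaussianLaw.integrable_pow hm 4)).sub
    ((HasGaussianLaw.integrable_pow hU 4).const_mul 2)).sub
    ((HasGaussianLaw.integrable_pow hV 4).const_mul 2)).div_const 12
  refine this.congr (ae_of_all _ fun ω => ?_)
  simp only [Pi.sub_apply, Pi.add_apply]
  ring

/-- Isserlis' theorem for two jointly Gaussian variables. -/
theorem integral_sq_mul_sq_of_hasGaussianLaw (hU : HasGaussianLaw U P) (hV : HasGaussianLaw V P)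
    (hp : HasGaussianLaw (fun ω => U ω + V ω) P) (hm : HasGaussianLaw (fun ω => U ω - V ω) P)
    (hU0 : ∫ ω, U ω ∂P = 0) (hV0 : ∫ ω, V ω ∂P = 0) :
    ∫ ω, U ω ^ 2 * V ω ^ 2 ∂P =
      (∫ ω, U ω ^ 2 ∂P) * (∫ ω, V ω ^ 2 ∂P) + 2 * (∫ ω, U ω * V ω ∂P) ^ 2 := by
  have iU := hU.integrable
  have iV := hV.integrable
  have iUV := integrable_mul_of_hasGaussianLaw hp hm
  have iU2 := HasGaussianLaw.integrable_pow hU 2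
  have iV2 := HasGaussianLaw.integrable_pow hV 2
  have iU4 := HasGaussianLaw.integrable_pow hU 4
  have iV4 := HasGaussianLaw.integrable_pow hV 4
  have iUV2 := integrable_sq_mul_sq_of_hasGaussianLaw hU hV hp hm
  have e0 := HasGaussianLaw.integral_pow_four hp (by rw [integral_add iU iV, hU0, hV0, add_zero])
  have e1 := HasGaussianLaw.integral_pow_four hm (by rw [integral_sub iU iV, hU0, hV0, sub_zero])
  have e2 := HasGaussianLaw.integral_pow_four hU hU0
  have e3 := HasGaussianLaw.integral_pow_four hV hV0
  have s0 : ∫ ω, (U ω + V ω) ^ 2 ∂P =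
      ∫ ω, U ω ^ 2 ∂P + 2 * ∫ ω, U ω * V ω ∂P + ∫ ω, V ω ^ 2 ∂P := by
    have j : Integrable (fun ω => U ω ^ 2 + 2 * (U ω * V ω)) P := iU2.add (iUV.const_mul 2)
    rw [← integral_const_mul, ← integral_add iU2 (iUV.const_mul 2), ← integral_add j iV2]
    congr 1; funext ω; ring
  have s1 : ∫ ω, (U ω - V ω) ^ 2 ∂P =
      ∫ ω, U ω ^ 2 ∂P - 2 * ∫ ω, U ω * V ω ∂P + ∫ ω, V ω ^ 2 ∂P := by
    have j : Integrable (fun ω => U ω ^ 2 - 2 * (U ω * V ω)) P := iU2.sub (iUV.const_mul 2)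
    rw [← integral_const_mul, ← integral_sub iU2 (iUV.const_mul 2), ← integral_add j iV2]
    congr 1; funext ω; ring
  -- Polarisation in degree four: U²V² is the only term here that is not a fourth power of a
  -- Gaussian variable, so the fourth moments determine its mean.
  have s2 : ∫ ω, (U ω + V ω) ^ 4 ∂P + ∫ ω, (U ω - V ω) ^ 4 ∂P =
      2 * ∫ ω, U ω ^ 4 ∂P + 12 * ∫ ω, U ω ^ 2 * V ω ^ 2 ∂P + 2 * ∫ ω, V ω ^ 4 ∂P := by
    have j : Integrable (fun ω => 2 * U ω ^ 4 + 12 * (U ω ^ 2 * V ω ^ 2)) P :=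
      (iU4.const_mul 2).add (iUV2.const_mul 12)
    rw [← integral_add (HasGaussianLaw.integrable_pow hp 4) (HasGaussianLaw.integrable_pow hm 4),
      ← integral_const_mul, ← integral_const_mul, ← integral_const_mul,
      ← integral_add (iU4.const_mul 2) (iUV2.const_mul 12),
      ← integral_add j (iV4.const_mul 2)]
    congr 1; funext ω; ring
  rw [e0, e1, e2, e3, s0, s1] at s2
  linear_combination -(1 / 12) * s2

theorem integral_centred_sq_mul_of_hasGaussianLaw (hU : HasGaussianLaw U P)
    (hV : HasGaussianLaw V P)
    (hp : HasGaussianLaw (fun ω => U ω + V ω) P) (hm : HasGaussianLaw (fun ω => U ω - V ω) P)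
    (hU0 : ∫ ω, U ω ∂P = 0) (hV0 : ∫ ω, V ω ∂P = 0) :
    Integrable (fun ω => (U ω ^ 2 - ∫ ω, U ω ^ 2 ∂P) * (V ω ^ 2 - ∫ ω, V ω ^ 2 ∂P)) P ∧
    ∫ ω, (U ω ^ 2 - ∫ ω, U ω ^ 2 ∂P) * (V ω ^ 2 - ∫ ω, V ω ^ 2 ∂P) ∂P =
      2 * (∫ ω, U ω * V ω ∂P) ^ 2 := by
  have := hU.isProbabilityMeasure
  have iU2 := HasGaussianLaw.integrable_pow hU 2
  have iV2 := HasGaussianLaw.integrable_pow hV 2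
  have iUV2 := integrable_sq_mul_sq_of_hasGaussianLaw hU hV hp hm
  have key := integral_sq_mul_sq_of_hasGaussianLaw hU hV hp hm hU0 hV0
  set a := ∫ ω, U ω ^ 2 ∂P
  set b := ∫ ω, V ω ^ 2 ∂P
  have eq : (fun ω => (U ω ^ 2 - a) * (V ω ^ 2 - b)) =
      fun ω => U ω ^ 2 * V ω ^ 2 - b * U ω ^ 2 - a * V ω ^ 2 + a * b := by
    funext ω; ring
  have i1 := iUV2.sub (iU2.const_mul b)
  have i2 := i1.sub (iV2.const_mul a)
  rw [eq]
  refine ⟨i2.add (integrable_const _), ?_⟩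
  rw [integral_add (f := fun ω => U ω ^ 2 * V ω ^ 2 - b * U ω ^ 2 - a * V ω ^ 2) i2
      (integrable_const _),
    integral_sub (f := fun ω => U ω ^ 2 * V ω ^ 2 - b * U ω ^ 2) i1 (iV2.const_mul a),
    integral_sub iUV2 (iU2.const_mul b), integral_const_mul, integral_const_mul, key]
  simp only [integral_const, probReal_univ, smul_eq_mul]
  simp only [a, b]
  ring

end GaussianMoments

/-! ### Quadratic variation of correlated Gaussian sequences -/

section GaussianSequence

variable {Ω : Type*} [MeasurableSpace Ω] {P : Measure Ω} {D : ℕ → Ω → ℝ} {v : ℝ}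

theorem integrable_mul_of_isGaussianProcess (hD : IsGaussianProcess D P) (i j : ℕ) :
    Integrable (fun ω => D i ω * D j ω) P :=
  integrable_mul_of_hasGaussianLaw hD.hasGaussianLaw_fun_add hD.hasGaussianLaw_fun_sub

theorem integral_sq_sum_eq (hD : IsGaussianProcess D P) (s : Finset ℕ) :
    ∫ ω, (∑ i ∈ s, D i ω) ^ 2 ∂P = ∑ i ∈ s, ∑ j ∈ s, ∫ ω, D i ω * D j ω ∂P := by
  simp_rw [sq, Finset.sum_mul_sum]
  rw [integral_finsetSum _ fun i _ => integrable_finsetSum _ fun j _ =>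
    integrable_mul_of_isGaussianProcess hD i j]
  refine Finset.sum_congr rfl fun i _ => ?_
  rw [integral_finsetSum _ fun j _ => integrable_mul_of_isGaussianProcess hD i j]

theorem integral_sq_sum_centred_sq (hD : IsGaussianProcess D P) (h0 : ∀ i, ∫ ω, D i ω ∂P = 0)
    (hv : ∀ i, ∫ ω, D i ω ^ 2 ∂P = v) (s : Finset ℕ) :
    Integrable (fun ω => (∑ i ∈ s, (D i ω ^ 2 - v)) ^ 2) P ∧
    ∫ ω, (∑ i ∈ s, (D i ω ^ 2 - v)) ^ 2 ∂P =
      ∑ i ∈ s, ∑ j ∈ s, 2 * (∫ ω, D i ω * D j ω ∂P) ^ 2 := by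
  have key (i j : ℕ) := integral_centred_sq_mul_of_hasGaussianLaw (hD.hasGaussianLaw_eval i)
    (hD.hasGaussianLaw_eval j) hD.hasGaussianLaw_fun_add hD.hasGaussianLaw_fun_sub (h0 i) (h0 j)
  simp only [hv] at key
  simp_rw [sq (∑ i ∈ s, _), Finset.sum_mul_sum]
  refine ⟨integrable_finsetSum _ fun i _ => integrable_finsetSum _ fun j _ => (key i j).1, ?_⟩
  rw [integral_finsetSum _ fun i _ => integrable_finsetSum _ fun j _ => (key i j).1]
  refine Finset.sum_congr rfl fun i _ => ?_
  rw [integral_finsetSum _ fun j _ => (key i j).1]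
  exact Finset.sum_congr rfl fun j _ => (key i j).2

/-- By |xy| ≤ (x² + y²)/2 a covariance is at most v in absolute value. This trades squared
covariances for absolute ones, which can be summed once their sign is known. -/
theorem sq_integral_mul_le (hD : IsGaussianProcess D P) (hv : ∀ i, ∫ ω, D i ω ^ 2 ∂P = v)
    (i j : ℕ) : (∫ ω, D i ω * D j ω ∂P) ^ 2 ≤ v * |∫ ω, D i ω * D j ω ∂P| := by
  have hle : |∫ ω, D i ω * D j ω ∂P| ≤ v := by
    have e : ∫ ω, (D i ω ^ 2 + D j ω ^ 2) / 2 ∂P = v := by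
      rw [integral_div, integral_add (HasGaussianLaw.integrable_pow (hD.hasGaussianLaw_eval i) 2)
        (HasGaussianLaw.integrable_pow (hD.hasGaussianLaw_eval j) 2), hv, hv]
      ring
    rw [← e]
    refine (abs_integral_le_integral_abs).trans (integral_mono
      (integrable_mul_of_isGaussianProcess hD i j).abs
      (((HasGaussianLaw.integrable_pow (hD.hasGaussianLaw_eval i) 2).add
        (HasGaussianLaw.integrable_pow (hD.hasGaussianLaw_eval j) 2)).div_const 2) fun ω => ?_)
    rw [abs_le]
    constructor <;> nlinarith [sq_nonneg (D i ω + D j ω), sq_nonneg (D i ω - D j ω)]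
  rw [← sq_abs, sq]
  exact mul_le_mul_of_nonneg_right hle (abs_nonneg _)

/-- With nonnegative covariances the sum of their absolute values is the second moment of the sum
itself. -/
theorem integral_sq_sum_centred_sq_le_of_nonneg (hD : IsGaussianProcess D P)
    (h0 : ∀ i, ∫ ω, D i ω ∂P = 0) (hv : ∀ i, ∫ ω, D i ω ^ 2 ∂P = v)
    (hpos : ∀ i j, i ≠ j → 0 ≤ ∫ ω, D i ω * D j ω ∂P) (s : Finset ℕ) :
    ∫ ω, (∑ i ∈ s, (D i ω ^ 2 - v)) ^ 2 ∂P ≤ 2 * v * ∫ ω, (∑ i ∈ s, D i ω) ^ 2 ∂P := by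
  rw [(integral_sq_sum_centred_sq hD h0 hv s).2, integral_sq_sum_eq hD, Finset.mul_sum]
  refine Finset.sum_le_sum fun i _ => ?_
  rw [Finset.mul_sum]
  refine Finset.sum_le_sum fun j _ => ?_
  have h := sq_integral_mul_le hD hv i j
  have hn : 0 ≤ ∫ ω, D i ω * D j ω ∂P := by
    by_cases hij : i = j
    · subst hij
      exact integral_nonneg fun ω => mul_self_nonneg _
    · exact hpos i j hij
  rw [abs_of_nonneg hn] at h
  linarith

/-- The sum of all covariances is a second moment, hence nonnegative, so the negative off-diagonal
part is dominated by the diagonal. The absolute values then sum to at most twice the diagonal. -/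
theorem integral_sq_sum_centred_sq_le_of_nonpos (hD : IsGaussianProcess D P)
    (h0 : ∀ i, ∫ ω, D i ω ∂P = 0) (hv : ∀ i, ∫ ω, D i ω ^ 2 ∂P = v)
    (hneg : ∀ i j, i ≠ j → ∫ ω, D i ω * D j ω ∂P ≤ 0) (s : Finset ℕ) :
    ∫ ω, (∑ i ∈ s, (D i ω ^ 2 - v)) ^ 2 ∂P ≤ 2 * v * (2 * s.card * v) := by
  have hv0 : 0 ≤ v := by
    rw [← hv 0]
    exact integral_nonneg fun ω => sq_nonneg _
  have hA : 0 ≤ ∑ i ∈ s, ∑ j ∈ s, ∫ ω, D i ω * D j ω ∂P := by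
    rw [← integral_sq_sum_eq hD]
    exact integral_nonneg fun ω => sq_nonneg _
  -- The bracket on the right is the absolute covariance: 2v - v on the diagonal and minus the
  -- covariance elsewhere.
  have hterm (i j : ℕ) : 2 * (∫ ω, D i ω * D j ω ∂P) ^ 2 ≤
      2 * v * ((if i = j then 2 * v else 0) - ∫ ω, D i ω * D j ω ∂P) := by
    have h := sq_integral_mul_le hD hv i j
    split_ifs with hij
    · subst hij
      have e : ∫ ω, D i ω * D i ω ∂P = v := by simp_rw [← sq]; exact hv i
      rw [e]
      nlinarith
    · rw [abs_of_nonpos (hneg i j hij)] at h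
      linarith
  rw [(integral_sq_sum_centred_sq hD h0 hv s).2]
  calc _ ≤ ∑ i ∈ s, ∑ j ∈ s, 2 * v * ((if i = j then 2 * v else 0) - ∫ ω, D i ω * D j ω ∂P) :=
        Finset.sum_le_sum fun i _ => Finset.sum_le_sum fun j _ => hterm i j
    _ = 2 * v * (2 * s.card * v - ∑ i ∈ s, ∑ j ∈ s, ∫ ω, D i ω * D j ω ∂P) := by
        simp_rw [← Finset.mul_sum, Finset.sum_sub_distrib]
        congr 2
        rw [Finset.sum_congr rfl fun i hi => by
          rw [Finset.sum_ite_eq, if_pos hi]]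
        simp
        ring
    _ ≤ _ := by
        refine mul_le_mul_of_nonneg_left ?_ (by positivity)
        linarith

end GaussianSequence

/-! ### Scalar fractional Brownian motion -/

/-- A real-valued centred Gaussian process on `[0,∞)` whose increments have variance
`|t - s| ^ (2 * H)`. -/
structure IsScalarFBM {Ω : Type*} [MeasurableSpace Ω] (P : Measure Ω) (H : ℝ)
    (X : ℝ → Ω → ℝ) : Prop where
  gaussian : IsGaussianProcess (fun t : ℝ≥0 => X t) P
  centred : ∀ t : ℝ, 0 ≤ t → ∫ ω, X t ω ∂P = 0
  sq_increment : ∀ s t : ℝ, 0 ≤ s → 0 ≤ t →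
    ∫ ω, (X t ω - X s ω) ^ 2 ∂P = |t - s| ^ (2 * H)

section ScalarFBM

variable {Ω : Type*} [MeasurableSpace Ω] {P : Measure Ω} {H : ℝ} {X : ℝ → Ω → ℝ}

theorem IsScalarFBM.hasGaussianLaw_sub (hX : IsScalarFBM P H X) {s t : ℝ} (hs : 0 ≤ s)
    (ht : 0 ≤ t) : HasGaussianLaw (fun ω => X t ω - X s ω) P :=
  hX.gaussian.hasGaussianLaw_fun_sub (s := ⟨t, ht⟩) (t := ⟨s, hs⟩)

theorem IsScalarFBM.isGaussianProcess_grid (hX : IsScalarFBM P H X) {h : ℝ} (hh : 0 ≤ h) :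
    IsGaussianProcess (fun (i : ℕ) ω => X ((i + 1 : ℕ) * h) ω - X (i * h) ω) P := by
  classical
  refine hX.gaussian.of_isGaussianProcess fun i => ?_
  let a : ℝ≥0 := ⟨i * h, by positivity⟩
  let b : ℝ≥0 := ⟨(i + 1 : ℕ) * h, by positivity⟩
  exact ⟨{a, b},
    { toFun x := x ⟨b, by simp⟩ - x ⟨a, by simp⟩
      map_add' x y := by simp; ring
      map_smul' c x := by simp; ring },
    fun ω => rfl⟩

theorem IsScalarFBM.integral_grid (hX : IsScalarFBM P H X) {h : ℝ} (hh : 0 ≤ h) (i : ℕ) :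
    ∫ ω, (X ((i + 1 : ℕ) * h) ω - X (i * h) ω) ∂P = 0 := by
  have h1 : 0 ≤ (i : ℝ) * h := by positivity
  have h2 : 0 ≤ ((i + 1 : ℕ) : ℝ) * h := by positivity
  have i1 : Integrable (X (i * h)) P := (hX.gaussian.hasGaussianLaw_eval ⟨_, h1⟩).integrable
  have i2 : Integrable (X ((i + 1 : ℕ) * h)) P :=
    (hX.gaussian.hasGaussianLaw_eval ⟨_, h2⟩).integrable
  rw [integral_sub i2 i1, hX.centred _ h1, hX.centred _ h2, sub_zero]

theorem IsScalarFBM.integral_sq_grid (hX : IsScalarFBM P H X) {h : ℝ} (hh : 0 ≤ h) (i : ℕ) :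
    ∫ ω, (X ((i + 1 : ℕ) * h) ω - X (i * h) ω) ^ 2 ∂P = h ^ (2 * H) := by
  rw [hX.sq_increment _ _ (by positivity) (by positivity)]
  congr 1
  rw [abs_of_nonneg] <;> push_cast <;> ring_nf
  exact hh

theorem IsScalarFBM.integral_mul_increment (hX : IsScalarFBM P H X) {a b c e : ℝ} (ha : 0 ≤ a)
    (hb : 0 ≤ b) (hc : 0 ≤ c) (he : 0 ≤ e) :
    ∫ ω, (X b ω - X a ω) * (X e ω - X c ω) ∂P =
      (|e - a| ^ (2 * H) + |c - b| ^ (2 * H) - |e - b| ^ (2 * H) - |c - a| ^ (2 * H)) / 2 := by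
  have i1 := HasGaussianLaw.integrable_pow (hX.hasGaussianLaw_sub ha he) 2
  have i2 := HasGaussianLaw.integrable_pow (hX.hasGaussianLaw_sub hb hc) 2
  have i3 := HasGaussianLaw.integrable_pow (hX.hasGaussianLaw_sub hb he) 2
  have i4 := HasGaussianLaw.integrable_pow (hX.hasGaussianLaw_sub ha hc) 2
  rw [← hX.sq_increment _ _ ha he, ← hX.sq_increment _ _ hb hc, ← hX.sq_increment _ _ hb he,
    ← hX.sq_increment _ _ ha hc, ← integral_add i1 i2]
  have i12 : Integrable (fun ω => (X e ω - X a ω) ^ 2 + (X c ω - X b ω) ^ 2) P := i1.add i2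
  rw [← integral_sub i12 i3]
  have i123 : Integrable (fun ω => (X e ω - X a ω) ^ 2 + (X c ω - X b ω) ^ 2 -
    (X e ω - X b ω) ^ 2) P := i12.sub i3
  rw [← integral_sub i123 i4, ← integral_div]
  congr 1
  funext ω
  ring

/-- Writing the later cell as i + (k + 1) makes k h the gap between the two cells. The covariance
becomes half a second difference of x^(2H), whose sign is a matter of convexity. -/
theorem IsScalarFBM.integral_mul_grid (hX : IsScalarFBM P H X) {h : ℝ} (hh : 0 ≤ h) (i k : ℕ) :
    ∫ ω, (X ((i + 1 : ℕ) * h) ω - X (i * h) ω) *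
        (X ((i + (k + 1) + 1 : ℕ) * h) ω - X ((i + (k + 1) : ℕ) * h) ω) ∂P =
      ((k * h + 2 * h) ^ (2 * H) + (k * h) ^ (2 * H)) / 2 - (k * h + h) ^ (2 * H) := by
  rw [hX.integral_mul_increment (by positivity) (by positivity) (by positivity) (by positivity)]
  have hk : 0 ≤ (k : ℝ) * h := by positivity
  have e1 : ((i + (k + 1) + 1 : ℕ) : ℝ) * h - i * h = k * h + 2 * h := by push_cast; ring
  have e2 : ((i + (k + 1) : ℕ) : ℝ) * h - (i + 1 : ℕ) * h = k * h := by push_cast; ring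
  have e3 : ((i + (k + 1) + 1 : ℕ) : ℝ) * h - (i + 1 : ℕ) * h = k * h + h := by push_cast; ring
  have e4 : ((i + (k + 1) : ℕ) : ℝ) * h - i * h = k * h + h := by push_cast; ring
  rw [e1, e2, e3, e4, abs_of_nonneg (by positivity), abs_of_nonneg hk,
    abs_of_nonneg (by positivity)]
  ring

theorem forall_ne_of_forall_add {p : ℕ → ℕ → Prop} (hsymm : ∀ i j, p i j → p j i)
    (h : ∀ i k, p i (i + (k + 1))) (i j : ℕ) (hij : i ≠ j) : p i j := by
  rcases lt_or_gt_of_ne hij with hlt | hlt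
  · obtain ⟨k, rfl⟩ := Nat.exists_eq_add_of_lt hlt
    exact h i k
  · obtain ⟨k, rfl⟩ := Nat.exists_eq_add_of_lt hlt
    exact hsymm _ _ (h j k)

theorem IsScalarFBM.integral_mul_grid_nonneg (hX : IsScalarFBM P H X) (hH : 1 / 2 ≤ H) {h : ℝ}
    (hh : 0 ≤ h) (i j : ℕ) (hij : i ≠ j) :
    0 ≤ ∫ ω, (X ((i + 1 : ℕ) * h) ω - X (i * h) ω) * (X ((j + 1 : ℕ) * h) ω - X (j * h) ω) ∂P := by
  refine forall_ne_of_forall_add (p := fun i j => 0 ≤ ∫ ω, (X ((i + 1 : ℕ) * h) ω - X (i * h) ω) *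
    (X ((j + 1 : ℕ) * h) ω - X (j * h) ω) ∂P) (fun i j h => ?_) (fun i k => ?_) i j hij
  · simpa only [mul_comm] using h
  · rw [hX.integral_mul_grid hh]
    have hk : 0 ≤ (k : ℝ) * h := by positivity
    have hk2 : 0 ≤ (k : ℝ) * h + 2 * h := by positivity
    have hc : ConvexOn ℝ (Ici 0) fun x : ℝ => x ^ (2 * H) := convexOn_rpow (by linarith)
    have := hc.2 (mem_Ici.2 hk2) (mem_Ici.2 hk) (by norm_num : (0 : ℝ) ≤ 1 / 2)
      (by norm_num : (0 : ℝ) ≤ 1 / 2) (by norm_num)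
    simp only [smul_eq_mul] at this
    rw [show 1 / 2 * (k * h + 2 * h) + 1 / 2 * (k * h) = k * h + h by ring] at this
    linarith

theorem IsScalarFBM.integral_mul_grid_nonpos (hX : IsScalarFBM P H X) (hH0 : 0 ≤ H)
    (hH : H ≤ 1 / 2) {h : ℝ} (hh : 0 ≤ h) (i j : ℕ) (hij : i ≠ j) :
    ∫ ω, (X ((i + 1 : ℕ) * h) ω - X (i * h) ω) * (X ((j + 1 : ℕ) * h) ω - X (j * h) ω) ∂P ≤ 0 := by
  refine forall_ne_of_forall_add (p := fun i j => ∫ ω, (X ((i + 1 : ℕ) * h) ω - X (i * h) ω) *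
    (X ((j + 1 : ℕ) * h) ω - X (j * h) ω) ∂P ≤ 0) (fun i j h => ?_) (fun i k => ?_) i j hij
  · simpa only [mul_comm] using h
  · rw [hX.integral_mul_grid hh]
    have hk : 0 ≤ (k : ℝ) * h := by positivity
    have hk2 : 0 ≤ (k : ℝ) * h + 2 * h := by positivity
    have hc : ConcaveOn ℝ (Ici 0) fun x : ℝ => x ^ (2 * H) :=
      Real.concaveOn_rpow (by linarith) (by linarith)
    have := hc.2 (mem_Ici.2 hk2) (mem_Ici.2 hk) (by norm_num : (0 : ℝ) ≤ 1 / 2)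
      (by norm_num : (0 : ℝ) ≤ 1 / 2) (by norm_num)
    simp only [smul_eq_mul] at this
    rw [show 1 / 2 * (k * h + 2 * h) + 1 / 2 * (k * h) = k * h + h by ring] at this
    linarith

/-- The exponent `1/2` if `H ≤ 1/2` and `1 - H` otherwise, which governs the fluctuations of the
scaled quadratic variation. -/
noncomputable def fluctExp (H : ℝ) : ℝ := if H ≤ 1 / 2 then 1 / 2 else 1 - H

/-- For H ≤ 1/2 covariances are nonpositive and the bound is of order N. For H > 1/2 they are
nonnegative, the increments telescope, and self-similarity gives N^(2H). Both orders are N^(2(1-r))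
with r = `fluctExp H`. -/
theorem IsScalarFBM.integral_sq_block_le (hX : IsScalarFBM P H X) (hH0 : 0 ≤ H) {h : ℝ}
    (hh : 0 < h) (a N : ℕ) :
    ∫ ω, (∑ i ∈ Finset.Ico a (a + N),
      ((X ((i + 1 : ℕ) * h) ω - X (i * h) ω) ^ 2 - h ^ (2 * H))) ^ 2 ∂P ≤
      (2 * h ^ (2 * H) * (N : ℝ) ^ (1 - fluctExp H)) ^ 2 := by
  have hD := hX.isGaussianProcess_grid hh.le
  have h0 := hX.integral_grid hh.le
  have hv := hX.integral_sq_grid hh.le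
  have hp : (h ^ (2 * H)) * h ^ (2 * H) = (h ^ (2 * H)) ^ 2 := by ring
  unfold fluctExp
  split_ifs with hH
  · refine (integral_sq_sum_centred_sq_le_of_nonpos hD h0 hv
      (hX.integral_mul_grid_nonpos hH0 hH hh.le) _).trans_eq ?_
    rw [mul_pow, ← Real.rpow_natCast ((N : ℝ) ^ _), ← Real.rpow_mul (by positivity)]
    norm_num
    ring
  · refine (integral_sq_sum_centred_sq_le_of_nonneg hD h0 hv
      (hX.integral_mul_grid_nonneg (by linarith) hh.le) _).trans ?_
    have e (ω : Ω) : ∑ i ∈ Finset.Ico a (a + N), (X ((i + 1 : ℕ) * h) ω - X (i * h) ω) =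
        X ((a + N : ℕ) * h) ω - X (a * h) ω :=
      Finset.sum_Ico_sub (fun i : ℕ => X (i * h) ω) (by omega)
    simp_rw [e]
    rw [hX.sq_increment _ _ (by positivity) (by positivity)]
    have e2 : |((a + N : ℕ) : ℝ) * h - a * h| = N * h := by
      rw [abs_of_nonneg] <;> push_cast <;> ring_nf
      positivity
    rw [e2, Real.mul_rpow (by positivity) hh.le, mul_pow, ← Real.rpow_natCast ((N : ℝ) ^ _),
      ← Real.rpow_mul (by positivity)]
    rw [show (1 - (1 - H)) * ((2 : ℕ) : ℝ) = 2 * H by push_cast; ring]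
    have : 0 ≤ (N : ℝ) ^ (2 * H) := by positivity
    have := mul_nonneg this (sq_nonneg (h ^ (2 * H)))
    nlinarith

end ScalarFBM

/-! ### Almost sure rate of the block sums of the quadratic variation -/

section BlockSums

/-- The sum over the `2 ^ m` dyadic blocks of `{0, …, 2 ^ n - 1}` of the absolute values of the
sums of `w` over the blocks. -/
noncomputable def blockSum (w : ℕ → ℝ) (n m : ℕ) : ℝ :=
  ∑ j ∈ Finset.range (2 ^ m),
    |∑ i ∈ Finset.Ico (j * 2 ^ (n - m)) (j * 2 ^ (n - m) + 2 ^ (n - m)), w i|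

/-- Deviation of the scaled squared increment of `x` from the length of the dyadic interval. -/
noncomputable def qvDev (T H : ℝ) (x : ℝ → ℝ) (n i : ℕ) : ℝ :=
  (T / 2 ^ n) ^ (1 - 2 * H) * (x (dyadic T n (i + 1)) - x (dyadic T n i)) ^ 2 - T / 2 ^ n

theorem dyadic_eq (T : ℝ) (n i : ℕ) : dyadic T n i = i * (T / 2 ^ n) := mul_div_assoc _ _ _

theorem dyadic_succ_sub (T : ℝ) (n i : ℕ) : dyadic T n (i + 1) - dyadic T n i = T / 2 ^ n := by
  simp only [dyadic_eq]
  push_cast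
  ring

theorem fluctExp_pos {H : ℝ} (hH1 : H < 1) : 0 < fluctExp H := by
  unfold fluctExp; split_ifs <;> linarith

theorem fluctExp_le_half (H : ℝ) : fluctExp H ≤ 1 / 2 := by
  unfold fluctExp; split_ifs <;> linarith

theorem le_one_sub_fluctExp (H : ℝ) : H ≤ 1 - fluctExp H := by
  unfold fluctExp; split_ifs <;> linarith

theorem floor_mul_le {r : ℝ} (hr1 : r ≤ 1) (n : ℕ) : ⌊r * n⌋₊ ≤ n := by
  refine Nat.floor_le_of_le ?_
  have : (0 : ℝ) ≤ n := n.cast_nonneg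
  nlinarith

variable {Ω : Type*} [MeasurableSpace Ω] {P : Measure Ω}

/-- Cauchy–Schwarz in the pointwise form |W| ≤ (W²/c + c)/2, which gives integrability at the same
time. -/
theorem integral_abs_le_of_integral_sq_le [IsProbabilityMeasure P] {W : Ω → ℝ} {c : ℝ} (hc : 0 < c)
    (hW : AEStronglyMeasurable W P) (hW2 : Integrable (fun ω => W ω ^ 2) P)
    (h : ∫ ω, W ω ^ 2 ∂P ≤ c ^ 2) :
    Integrable (fun ω => |W ω|) P ∧ ∫ ω, |W ω| ∂P ≤ c := by
  have hint : Integrable (fun ω => (W ω ^ 2 / c + c) / 2) P :=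
    ((hW2.div_const c).add (integrable_const c)).div_const 2
  have hle (ω : Ω) : |W ω| ≤ (W ω ^ 2 / c + c) / 2 := by
    rw [← sq_abs (W ω)]
    have h1 : 0 ≤ (|W ω| - c) ^ 2 / c := by positivity
    have h2 : (|W ω| - c) ^ 2 / c = |W ω| ^ 2 / c - 2 * |W ω| + c := by field_simp; ring
    linarith
  have hi : Integrable (fun ω => |W ω|) P :=
    hint.mono' hW.norm (ae_of_all _ fun ω => by simpa using hle ω)
  refine ⟨hi, (integral_mono hi hint hle).trans ?_⟩
  rw [integral_div, integral_add (hW2.div_const c) (integrable_const c), integral_div]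
  simp only [integral_const, probReal_univ, smul_eq_mul, one_mul]
  have : (∫ ω, W ω ^ 2 ∂P) / c ≤ c := by
    rw [div_le_iff₀ hc]
    nlinarith
  linarith

/-- The series of the S n has finite mean, so it converges almost surely, and its sum bounds every
term. -/
theorem ae_exists_forall_le_of_summable_integral {S : ℕ → Ω → ℝ} (h0 : ∀ n ω, 0 ≤ S n ω)
    (hi : ∀ n, Integrable (S n) P) {a : ℕ → ℝ} (ha : Summable a) (hle : ∀ n, ∫ ω, S n ω ∂P ≤ a n) :
    ∀ᵐ ω ∂P, ∃ C, ∀ n, S n ω ≤ C := by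
  have hsum : ∫⁻ ω, ∑' n, ENNReal.ofReal (S n ω) ∂P ≠ ∞ := by
    rw [lintegral_tsum fun n => (hi n).aemeasurable.ennreal_ofReal]
    refine ne_top_of_le_ne_top ha.tsum_ofReal_ne_top (ENNReal.tsum_le_tsum fun n => ?_)
    rw [← ofReal_integral_eq_lintegral_ofReal (hi n) (ae_of_all _ (h0 n))]
    exact ENNReal.ofReal_le_ofReal (hle n)
  filter_upwards [ae_lt_top' (AEMeasurable.tsum fun n =>
    (hi n).aemeasurable.ennreal_ofReal) hsum] with ω hω
  refine ⟨(∑' n, ENNReal.ofReal (S n ω)).toReal, fun n => ?_⟩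
  rw [← ENNReal.toReal_ofReal (h0 n ω)]
  exact ENNReal.toReal_mono hω.ne (ENNReal.le_tsum n)

variable {H T : ℝ} {X : ℝ → Ω → ℝ}

theorem IsScalarFBM.integral_abs_sum_qvDev_le [IsProbabilityMeasure P] (hX : IsScalarFBM P H X)
    (hH0 : 0 ≤ H) (hT : 0 < T) (n a N : ℕ) (hN : 0 < N) :
    Integrable (fun ω => |∑ i ∈ Finset.Ico a (a + N), qvDev T H (fun t => X t ω) n i|) P ∧
    ∫ ω, |∑ i ∈ Finset.Ico a (a + N), qvDev T H (fun t => X t ω) n i| ∂P ≤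
      2 * (T / 2 ^ n) * (N : ℝ) ^ (1 - fluctExp H) := by
  have hh : 0 < T / 2 ^ n := by positivity
  have hD := hX.isGaussianProcess_grid hh.le
  have e (ω : Ω) : ∑ i ∈ Finset.Ico a (a + N), qvDev T H (fun t => X t ω) n i =
      (T / 2 ^ n) ^ (1 - 2 * H) * ∑ i ∈ Finset.Ico a (a + N),
        ((X ((i + 1 : ℕ) * (T / 2 ^ n)) ω - X (i * (T / 2 ^ n)) ω) ^ 2 - (T / 2 ^ n) ^ (2 * H)) := by
    rw [Finset.mul_sum]
    refine Finset.sum_congr rfl fun i _ => ?_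
    simp only [qvDev, dyadic_eq]
    rw [mul_sub, ← Real.rpow_add hh, sub_add_cancel, Real.rpow_one]
  simp_rw [e]
  refine integral_abs_le_of_integral_sq_le (by positivity) ?_ ?_ ?_
  · refine AEMeasurable.aestronglyMeasurable (AEMeasurable.const_mul
      (Finset.aemeasurable_fun_sum _ fun i _ => ?_) _)
    exact ((hD.aemeasurable i).pow_const 2).sub_const _
  · simp_rw [mul_pow]
    exact (integral_sq_sum_centred_sq hD (hX.integral_grid hh.le)
      (hX.integral_sq_grid hh.le) _).1.const_mul _
  · simp_rw [mul_pow _ (Finset.sum _ _)]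
    rw [integral_const_mul]
    refine (mul_le_mul_of_nonneg_left (hX.integral_sq_block_le hH0 hh a N)
      (sq_nonneg _)).trans_eq ?_
    rw [← mul_pow]
    congr 1
    have : (T / 2 ^ n) ^ (1 - 2 * H) * (T / 2 ^ n) ^ (2 * H) = T / 2 ^ n := by
      rw [← Real.rpow_add hh, sub_add_cancel, Real.rpow_one]
    linear_combination (2 * (N : ℝ) ^ (1 - fluctExp H)) * this

/-- With m = ⌊rn⌋, the 2^m blocks of length 2^(n-m) contribute 2T · 2^(-r(n-m)) in all, and n - m ≥
(1-r) n ≥ H n. -/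
theorem IsScalarFBM.integral_blockSum_le [IsProbabilityMeasure P] (hX : IsScalarFBM P H X)
    (hH0 : 0 ≤ H) (hH1 : H < 1) (hT : 0 < T) (n : ℕ) :
    Integrable (fun ω => blockSum (qvDev T H (fun t => X t ω) n) n ⌊fluctExp H * n⌋₊) P ∧
    ∫ ω, blockSum (qvDev T H (fun t => X t ω) n) n ⌊fluctExp H * n⌋₊ ∂P ≤
      2 * T * (2 : ℝ) ^ (-(fluctExp H * H * n)) := by
  have hr := fluctExp_pos hH1
  have hr1 := fluctExp_le_half H
  have hr2 := le_one_sub_fluctExp H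
  set r := fluctExp H with hrdef
  have hm := floor_mul_le (by linarith) n
  have hmr : (⌊r * n⌋₊ : ℝ) ≤ r * n := Nat.floor_le (by positivity)
  set m := ⌊r * n⌋₊
  have key (j : ℕ) := hX.integral_abs_sum_qvDev_le hH0 hT n (j * 2 ^ (n - m)) (2 ^ (n - m))
    (by positivity)
  refine ⟨integrable_finsetSum _ fun j _ => (key j).1, ?_⟩
  unfold blockSum
  rw [integral_finsetSum _ fun j _ => (key j).1]
  refine (Finset.sum_le_sum fun j _ => (key j).2).trans ?_
  rw [← hrdef, Finset.sum_const, Finset.card_range, nsmul_eq_mul]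
  have e : ((2 ^ m : ℕ) : ℝ) * (2 * (T / 2 ^ n) * ((2 ^ (n - m) : ℕ) : ℝ) ^ (1 - r)) =
      2 * T * (2 : ℝ) ^ (-((n - m) * r) : ℝ) := by
    push_cast
    rw [← Real.rpow_natCast 2 m, ← Real.rpow_natCast 2 n, ← Real.rpow_natCast 2 (n - m),
      ← Real.rpow_mul (by norm_num), Nat.cast_sub hm, div_eq_mul_inv, ← Real.rpow_neg (by norm_num)]
    have : (2 : ℝ) ^ (-((n - m) * r) : ℝ) =
        2 ^ (m : ℝ) * 2 ^ (-(n : ℝ)) * 2 ^ ((n - m : ℝ) * (1 - r)) := by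
      rw [← Real.rpow_add (by norm_num), ← Real.rpow_add (by norm_num)]
      congr 1; ring
    rw [this]; ring
  rw [e]
  refine mul_le_mul_of_nonneg_left (Real.rpow_le_rpow_of_exponent_le (by norm_num) ?_)
    (by positivity)
  have hn : (0 : ℝ) ≤ n := n.cast_nonneg
  have h1 : r * ((1 - r) * n) ≤ r * (n - m) := mul_le_mul_of_nonneg_left (by linarith) hr.le
  have h2 : r * H * n ≤ r * (1 - r) * n := by gcongr
  linarith

theorem blockSum_nonneg (w : ℕ → ℝ) (n m : ℕ) : 0 ≤ blockSum w n m :=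
  Finset.sum_nonneg fun _ _ => abs_nonneg _

theorem IsScalarFBM.ae_blockSum_le [IsProbabilityMeasure P] (hX : IsScalarFBM P H X)
    (hH0 : 0 ≤ H) (hH1 : H < 1) (hT : 0 < T) {κ : ℝ} (hκ : κ < fluctExp H * H) :
    ∀ᵐ ω ∂P, ∃ C, ∀ n : ℕ, blockSum (qvDev T H (fun t => X t ω) n) n ⌊fluctExp H * n⌋₊ ≤
      C * (2 : ℝ) ^ (-(κ * n)) := by
  have key (n : ℕ) := hX.integral_blockSum_le hH0 hH1 hT n
  have h := ae_exists_forall_le_of_summable_integral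
    (S := fun n ω => (2 : ℝ) ^ (κ * n) *
      blockSum (qvDev T H (fun t => X t ω) n) n ⌊fluctExp H * n⌋₊)
    (a := fun n => 2 * T * ((2 : ℝ) ^ (κ - fluctExp H * H)) ^ n)
    (fun n ω => mul_nonneg (by positivity) (blockSum_nonneg _ _ _))
    (fun n => (key n).1.const_mul _)
    ((summable_geometric_of_lt_one (by positivity)
      (Real.rpow_lt_one_of_one_lt_of_neg (by norm_num) (by linarith))).mul_left _)
    (fun n => by
      rw [integral_const_mul, ← Real.rpow_natCast (_ ^ _) n, ← Real.rpow_mul (by norm_num)]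
      refine (mul_le_mul_of_nonneg_left (key n).2 (by positivity)).trans_eq ?_
      rw [sub_mul, sub_eq_add_neg, Real.rpow_add (by norm_num)]
      ring)
  filter_upwards [h] with ω hω
  obtain ⟨C, hC⟩ := hω
  refine ⟨C, fun n => ?_⟩
  rw [Real.rpow_neg (by norm_num), ← div_eq_mul_inv, le_div_iff₀ (by positivity), mul_comm]
  exact hC n

end BlockSums

/-! ### Projections of a vector-valued fractional Brownian motion -/

/-- The components are uncorrelated with equal covariance, so projection on a unit vector preserves
the covariance. Directions other than the axes are needed for polarisation. -/
theorem FracDiff.IsFBM.isScalarFBM {Ω : Type*} [MeasurableSpace Ω] {P : Measure Ω} {K : ℕ} {H : ℝ}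
    (hH : H ≠ 0) {B : ℝ → Ω → E K} (hB : IsFBM P H B) (a : Fin K → ℝ) (ha : ∑ i, a i ^ 2 = 1) :
    IsScalarFBM P H (fun t ω => ∑ i, a i * B t ω i) := by
  have hcoord (t : ℝ) (ht : 0 ≤ t) (i : Fin K) : HasGaussianLaw (fun ω => B t ω i) P :=
    (hB.gaussian.hasGaussianLaw_eval ⟨t, ht⟩).map_fun (EuclideanSpace.proj i)
  have hg : IsGaussianProcess (fun (p : ℝ≥0 × Fin K) ω => B p.1 ω p.2) P :=
    (hB.gaussian.comp_right Prod.fst).comp_left fun p => EuclideanSpace.proj p.2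
  have hprod (s t : ℝ) (hs : 0 ≤ s) (ht : 0 ≤ t) (i j : Fin K) :
      Integrable (fun ω => B t ω i * B s ω j) P :=
    integrable_mul_of_hasGaussianLaw
      (hg.hasGaussianLaw_fun_add (s := (⟨t, ht⟩, i)) (t := (⟨s, hs⟩, j)))
      (hg.hasGaussianLaw_fun_sub (s := (⟨t, ht⟩, i)) (t := (⟨s, hs⟩, j)))
  have hcov (s t : ℝ) (hs : 0 ≤ s) (ht : 0 ≤ t) :
      Integrable (fun ω => (∑ i, a i * B t ω i) * ∑ i, a i * B s ω i) P ∧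
      ∫ ω, (∑ i, a i * B t ω i) * ∑ i, a i * B s ω i ∂P =
        (1 / 2) * (t ^ (2 * H) + s ^ (2 * H) - |t - s| ^ (2 * H)) := by
    have e (ω : Ω) : (∑ i, a i * B t ω i) * ∑ i, a i * B s ω i =
        ∑ i, ∑ j, a i * a j * (B t ω i * B s ω j) := by
      rw [Finset.sum_mul_sum]
      refine Finset.sum_congr rfl fun i _ => Finset.sum_congr rfl fun j _ => by ring
    simp_rw [e]
    refine ⟨integrable_finsetSum _ fun i _ => integrable_finsetSum _ fun j _ =>
      (hprod s t hs ht i j).const_mul _, ?_⟩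
    rw [integral_finsetSum _ fun i _ => integrable_finsetSum _ fun j _ =>
      (hprod s t hs ht i j).const_mul _]
    simp_rw [integral_finsetSum _ fun j _ => (hprod s t hs ht _ j).const_mul _,
      integral_const_mul, hB.covariance s t hs ht]
    simp only [mul_ite, mul_zero, Finset.sum_ite_eq, Finset.mem_univ, if_true]
    rw [← Finset.sum_mul]
    simp_rw [← sq]
    rw [ha, one_mul]
  refine ⟨?_, fun t ht => ?_, fun s t hs ht => ?_⟩
  · have := hB.gaussian.comp_left fun _ => ∑ i, a i • (EuclideanSpace.proj i : E K →L[ℝ] ℝ)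
    convert! this using 3 with t ω
    simp
  · rw [integral_finsetSum _ fun i _ => (hcoord t ht i).integrable.const_mul _]
    simp_rw [integral_const_mul, hB.centred t ht]
    simp
  · have h1 := hcov t t ht ht
    have h2 := hcov s s hs hs
    have h3 := hcov s t hs ht
    have e (ω : Ω) : (∑ i, a i * B t ω i - ∑ i, a i * B s ω i) ^ 2 =
        (∑ i, a i * B t ω i) * (∑ i, a i * B t ω i) +
        (∑ i, a i * B s ω i) * (∑ i, a i * B s ω i) -
        2 * ((∑ i, a i * B t ω i) * (∑ i, a i * B s ω i)) := by ring
    have h12 : Integrable (fun ω => (∑ i, a i * B t ω i) * (∑ i, a i * B t ω i) +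
        (∑ i, a i * B s ω i) * (∑ i, a i * B s ω i)) P := h1.1.add h2.1
    simp_rw [e]
    rw [integral_sub h12 (h3.1.const_mul 2), integral_add h1.1 h2.1,
      integral_const_mul, h1.2, h2.2, h3.2]
    -- `hH` is needed for |t - t|^(2H) = 0, since 0^0 = 1.
    simp [hH]
    ring

/-! ### Two-parameter Hölder bounds -/

/-- `‖F s t‖ ≤ C (t - s) ^ a` for `0 ≤ s ≤ t ≤ T` and some finite constant `C`. -/
def TwoParamHolder {W : Type*} [NormedAddCommGroup W] (T a : ℝ) (F : ℝ → ℝ → W) : Prop :=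
  ∃ C, 0 ≤ C ∧ ∀ s t, 0 ≤ s → s ≤ t → t ≤ T → ‖F s t‖ ≤ C * (t - s) ^ a

section TwoParamHolder

variable {W : Type*} [NormedAddCommGroup W] {T a b : ℝ} {F G : ℝ → ℝ → W}

theorem TwoParamHolder.of_holderSemi₂_lt_top (ha : a ≠ 0) (h : holderSemi₂ T a F < ∞) :
    TwoParamHolder T a F := by
  refine ⟨(holderSemi₂ T a F).toReal, ENNReal.toReal_nonneg, fun s t hs hst ht => ?_⟩
  have hle : ‖F s t‖ₑ / ENNReal.ofReal ((t - s) ^ a) ≤ holderSemi₂ T a F :=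
    le_iSup₂_of_le s ⟨hs, hst.trans ht⟩ (le_iSup₂_of_le t ⟨hst, ht⟩ le_rfl)
  -- On the diagonal the quotient has denominator zero, and finiteness of the seminorm forces F s s
  -- = 0.
  rcases hst.eq_or_lt with rfl | hlt
  · rw [sub_self, Real.zero_rpow ha, ENNReal.ofReal_zero] at hle
    have : ‖F s s‖ₑ = 0 := by
      by_contra hne
      rw [ENNReal.div_zero hne] at hle
      exact absurd h (not_lt.2 hle)
    rw [enorm_eq_zero] at this
    simp [this, Real.zero_rpow ha]
  · have hpos : 0 < (t - s) ^ a := Real.rpow_pos_of_pos (sub_pos.2 hlt) _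
    have h2 := ENNReal.toReal_mono h.ne hle
    rw [ENNReal.toReal_div, ENNReal.toReal_ofReal hpos.le, toReal_enorm, div_le_iff₀ hpos] at h2
    exact h2

theorem TwoParamHolder.congr (hF : TwoParamHolder T a F)
    (h : ∀ s t, 0 ≤ s → s ≤ t → t ≤ T → F s t = G s t) : TwoParamHolder T a G := by
  obtain ⟨C, hC, hb⟩ := hF
  exact ⟨C, hC, fun s t hs hst ht => h s t hs hst ht ▸ hb s t hs hst ht⟩

theorem TwoParamHolder.of_norm_le {W' : Type*} [NormedAddCommGroup W'] {G : ℝ → ℝ → W'}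
    (hF : TwoParamHolder T a F) {M : ℝ} (hM : 0 ≤ M)
    (h : ∀ s t, 0 ≤ s → s ≤ t → t ≤ T → ‖G s t‖ ≤ M * ‖F s t‖) : TwoParamHolder T a G := by
  obtain ⟨C, hC, hb⟩ := hF
  refine ⟨M * C, by positivity, fun s t hs hst ht => (h s t hs hst ht).trans ?_⟩
  rw [mul_assoc]
  exact mul_le_mul_of_nonneg_left (hb s t hs hst ht) hM

theorem TwoParamHolder.add (hF : TwoParamHolder T a F) (hG : TwoParamHolder T a G) :
    TwoParamHolder T a (fun s t => F s t + G s t) := by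
  obtain ⟨C, hC, hF⟩ := hF
  obtain ⟨C', hC', hG⟩ := hG
  refine ⟨C + C', by positivity, fun s t hs hst ht => (norm_add_le _ _).trans ?_⟩
  rw [add_mul]
  exact add_le_add (hF s t hs hst ht) (hG s t hs hst ht)

theorem TwoParamHolder.sum {ι : Type*} (I : Finset ι) {F : ι → ℝ → ℝ → W}
    (hF : ∀ i ∈ I, TwoParamHolder T a (F i)) :
    TwoParamHolder T a (fun s t => ∑ i ∈ I, F i s t) := by
  classical
  induction I using Finset.induction_on with
  | empty => exact ⟨0, le_rfl, fun s t _ _ _ => by simp⟩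
  | insert i I hi ih =>
    simp_rw [Finset.sum_insert hi]
    exact (hF i (by simp)).add (ih fun j hj => hF j (Finset.mem_insert_of_mem hj))

theorem TwoParamHolder.mono_exponent (hF : TwoParamHolder T b F) (ha : 0 < a) (hab : a ≤ b) :
    TwoParamHolder T a F := by
  obtain ⟨C, hC, hF⟩ := hF
  rcases lt_or_ge T 0 with hT | hT
  · exact ⟨0, le_rfl, fun s t hs hst ht => by linarith⟩
  refine ⟨C * T ^ (b - a), by positivity, fun s t hs hst ht => (hF s t hs hst ht).trans ?_⟩
  rw [mul_assoc]
  refine mul_le_mul_of_nonneg_left ?_ hC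
  rcases hst.eq_or_lt with rfl | hlt
  · simp [Real.zero_rpow ha.ne', Real.zero_rpow (ha.trans_le hab).ne']
  · have hpos := sub_pos.2 hlt
    calc (t - s) ^ b = (t - s) ^ (b - a) * (t - s) ^ a := by
          rw [← Real.rpow_add hpos, sub_add_cancel]
      _ ≤ T ^ (b - a) * (t - s) ^ a := by
          gcongr
          · linarith

theorem TwoParamHolder.exists_norm_le {x : ℝ → W} (ha : 0 ≤ a)
    (h : TwoParamHolder T a (fun s t => x t - x s)) :
    ∃ M, 0 ≤ M ∧ ∀ t, 0 ≤ t → t ≤ T → ‖x t‖ ≤ M := by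
  obtain ⟨C, hC, hb⟩ := h
  refine ⟨‖x 0‖ + C * |T| ^ a, by positivity, fun t ht htT => ?_⟩
  have h1 := hb 0 t le_rfl ht htT
  rw [sub_zero] at h1
  have h2 : t ^ a ≤ |T| ^ a := Real.rpow_le_rpow ht (htT.trans (le_abs_self T)) ha
  have h3 := norm_le_norm_add_norm_sub' (x t) (x 0)
  have h4 := mul_le_mul_of_nonneg_left h2 hC
  linarith

theorem TwoParamHolder.continuousOn {x : ℝ → W} (ha : 0 < a)
    (h : TwoParamHolder T a (fun s t => x t - x s)) : ContinuousOn x (Icc 0 T) := by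
  obtain ⟨C, hC, hb⟩ := h
  intro s hs
  have hle : ∀ t ∈ Icc 0 T, dist (x t) (x s) ≤ C * |t - s| ^ a := fun t ht => by
    rw [dist_eq_norm]
    rcases le_total s t with hst | hst
    · rw [abs_of_nonneg (sub_nonneg.2 hst)]
      exact hb s t hs.1 hst ht.2
    · rw [norm_sub_rev, abs_sub_comm, abs_of_nonneg (sub_nonneg.2 hst)]
      exact hb t s ht.1 hst hs.2
  have hlim : Tendsto (fun t => C * |t - s| ^ a) (𝓝[Icc 0 T] s) (𝓝 0) := by
    have hc : Continuous fun t : ℝ => C * |t - s| ^ a :=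
      continuous_const.mul ((continuous_abs.comp (continuous_id.sub continuous_const)).rpow_const
        fun _ => Or.inr ha.le)
    have := (hc.tendsto s).mono_left (nhdsWithin_le_nhds (s := Icc 0 T))
    simpa [Real.zero_rpow ha.ne'] using this
  rw [ContinuousWithinAt, tendsto_iff_dist_tendsto_zero]
  refine squeeze_zero' (Eventually.of_forall fun _ => dist_nonneg) ?_ hlim
  filter_upwards [self_mem_nhdsWithin] with t ht using hle t ht

theorem TwoParamHolder.mul {x z : ℝ → ℝ} (ha : 0 ≤ a)
    (hx : TwoParamHolder T a (fun s t => x t - x s))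
    (hz : TwoParamHolder T a (fun s t => z t - z s)) :
    TwoParamHolder T a (fun s t => x t * z t - x s * z s) := by
  obtain ⟨M, hM, hxM⟩ := hx.exists_norm_le ha
  obtain ⟨M', hM', hzM⟩ := hz.exists_norm_le ha
  have h1 : TwoParamHolder T a (fun s t => (x t - x s) * z t) :=
    hx.of_norm_le hM' fun s t hs hst ht => by
      rw [norm_mul, mul_comm]
      exact mul_le_mul_of_nonneg_right (hzM t (hs.trans hst) ht) (norm_nonneg _)
  have h2 : TwoParamHolder T a (fun s t => x s * (z t - z s)) :=
    hz.of_norm_le hM fun s t hs hst ht => by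
      rw [norm_mul]
      exact mul_le_mul_of_nonneg_right (hxM s hs (hst.trans ht)) (norm_nonneg _)
  exact (h1.add h2).congr fun s t _ _ _ => by ring

theorem TwoParamHolder.const_mul {x : ℝ → ℝ} (c : ℝ)
    (hx : TwoParamHolder T a (fun s t => x t - x s)) :
    TwoParamHolder T a (fun s t => c * x t - c * x s) :=
  hx.of_norm_le (abs_nonneg c) fun s t _ _ _ => by rw [← mul_sub, norm_mul, Real.norm_eq_abs]

end TwoParamHolder

/-! ### Riemann sums along dyadic partitions -/

section Dyadic

variable {T : ℝ}

theorem dyadic_nonneg (hT : 0 < T) (n i : ℕ) : 0 ≤ dyadic T n i := by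
  unfold dyadic; positivity

theorem dyadic_mono (hT : 0 < T) (n : ℕ) {i j : ℕ} (hij : i ≤ j) :
    dyadic T n i ≤ dyadic T n j := by
  unfold dyadic; gcongr

theorem dyadic_le (hT : 0 < T) {n i : ℕ} (hi : i ≤ 2 ^ n) : dyadic T n i ≤ T := by
  refine (dyadic_mono hT n hi).trans_eq ?_
  simp [dyadic]

theorem dyadic_succ_le (hT : 0 < T) {n i : ℕ} (hi : i ∈ Finset.range (2 ^ n)) :
    dyadic T n (i + 1) ≤ T :=
  dyadic_le hT (Finset.mem_range.1 hi)

theorem step_rpow (hT : 0 < T) (n : ℕ) (a : ℝ) :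
    (T / 2 ^ n) ^ a = T ^ a * (2 : ℝ) ^ (-(a * n)) := by
  rw [Real.div_rpow hT.le (by positivity), div_eq_mul_inv, ← Real.rpow_natCast 2 n,
    ← Real.rpow_mul (by norm_num), ← Real.rpow_neg (by norm_num), mul_comm (n : ℝ)]

theorem two_rpow_neg_mul_le {a b : ℝ} (hab : a ≤ b) (n : ℕ) :
    (2 : ℝ) ^ (-(b * n)) ≤ (2 : ℝ) ^ (-(a * n)) :=
  Real.rpow_le_rpow_of_exponent_le (by norm_num)
    (neg_le_neg (mul_le_mul_of_nonneg_right hab n.cast_nonneg))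

theorem isBigO_two_rpow_of_le {f : ℕ → ℝ} {a b C : ℝ} (hC : 0 ≤ C) (hab : a ≤ b)
    (h : ∀ n, |f n| ≤ C * (2 : ℝ) ^ (-(b * n))) :
    f =O[atTop] fun n : ℕ => (2 : ℝ) ^ (-(a * n)) := by
  refine Asymptotics.IsBigO.of_bound C (Eventually.of_forall fun n => ?_)
  rw [Real.norm_eq_abs, Real.norm_of_nonneg (by positivity)]
  exact (h n).trans (mul_le_mul_of_nonneg_left (two_rpow_neg_mul_le hab n) hC)

theorem riemannSum_sub_integral_isBigO {a : ℝ} (hT : 0 < T) (ha : 0 < a) {g : ℝ → ℝ}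
    (hg : TwoParamHolder T a (fun s t => g t - g s)) :
    (fun n => ∑ i ∈ Finset.range (2 ^ n), g (dyadic T n i) * (T / 2 ^ n) - ∫ t in (0 : ℝ)..T, g t)
      =O[atTop] fun n : ℕ => (2 : ℝ) ^ (-(a * n)) := by
  have hcont := hg.continuousOn ha
  obtain ⟨C, hC, hb⟩ := hg
  refine isBigO_two_rpow_of_le (C := T * C * T ^ a) (by positivity) le_rfl fun n => ?_
  have hh : 0 < T / 2 ^ n := by positivity
  have hint (i : ℕ) (hi : i ∈ Finset.range (2 ^ n)) :
      IntervalIntegrable g volume (dyadic T n i) (dyadic T n (i + 1)) := by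
    refine (hcont.mono fun t ht => ?_).intervalIntegrable
    rw [uIcc_of_le (dyadic_mono hT n i.le_succ)] at ht
    exact ⟨(dyadic_nonneg hT n i).trans ht.1, ht.2.trans (dyadic_succ_le hT hi)⟩
  have hsum := intervalIntegral.sum_integral_adjacent_intervals (f := g) (μ := volume)
    (a := dyadic T n) (n := 2 ^ n) fun i hi => hint i (Finset.mem_range.2 hi)
  have e0 : dyadic T n 0 = 0 := by simp [dyadic]
  have e1 : dyadic T n (2 ^ n) = T := by simp [dyadic]
  rw [e0, e1] at hsum
  rw [← hsum, ← Finset.sum_sub_distrib]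
  have hterm (i : ℕ) (hi : i ∈ Finset.range (2 ^ n)) :
      |g (dyadic T n i) * (T / 2 ^ n) - ∫ t in dyadic T n i..dyadic T n (i + 1), g t| ≤
        C * (T / 2 ^ n) ^ a * (T / 2 ^ n) := by
    have e : g (dyadic T n i) * (T / 2 ^ n) - ∫ t in dyadic T n i..dyadic T n (i + 1), g t =
        ∫ t in dyadic T n i..dyadic T n (i + 1), (g (dyadic T n i) - g t) := by
      rw [intervalIntegral.integral_sub intervalIntegrable_const (hint i hi),
        intervalIntegral.integral_const, dyadic_succ_sub, smul_eq_mul, mul_comm]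
    rw [e, ← Real.norm_eq_abs]
    refine (intervalIntegral.norm_integral_le_of_norm_le_const
      (C := C * (T / 2 ^ n) ^ a) fun t ht => ?_).trans_eq ?_
    · rw [uIoc_of_le (dyadic_mono hT n i.le_succ)] at ht
      rw [norm_sub_rev]
      refine (hb _ t (dyadic_nonneg hT n i) ht.1.le (ht.2.trans (dyadic_succ_le hT hi))).trans ?_
      have := dyadic_succ_sub T n i
      refine mul_le_mul_of_nonneg_left (Real.rpow_le_rpow ?_ ?_ ha.le) hC <;> linarith [ht.1, ht.2]
    · rw [dyadic_succ_sub, abs_of_pos hh]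
  refine (Finset.abs_sum_le_sum_abs _ _).trans ((Finset.sum_le_sum hterm).trans_eq ?_)
  rw [Finset.sum_const, Finset.card_range, nsmul_eq_mul, step_rpow hT]
  push_cast
  field_simp

end Dyadic

/-! ### Weighted sums of weights with small block sums -/

section WeightedSums

theorem sum_range_mul_eq_sum_blocks {R : Type*} [AddCommMonoid R] (f : ℕ → R) (a N : ℕ) :
    ∑ i ∈ Finset.range (a * N), f i =
      ∑ j ∈ Finset.range a, ∑ i ∈ Finset.Ico (j * N) (j * N + N), f i := by
  induction a with
  | zero => simp
  | succ a ih =>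
    rw [Finset.sum_range_succ, ← ih, Nat.succ_mul, Finset.range_eq_Ico, Finset.range_eq_Ico,
      Finset.sum_Ico_consecutive _ (Nat.zero_le _) (Nat.le_add_right _ _)]

theorem sum_range_two_pow_eq_sum_blocks {R : Type*} [AddCommMonoid R] (f : ℕ → R) {n m : ℕ}
    (hm : m ≤ n) : ∑ i ∈ Finset.range (2 ^ n), f i = ∑ j ∈ Finset.range (2 ^ m),
      ∑ i ∈ Finset.Ico (j * 2 ^ (n - m)) (j * 2 ^ (n - m) + 2 ^ (n - m)), f i := by
  rw [← sum_range_mul_eq_sum_blocks, ← pow_add, Nat.add_sub_cancel' hm]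

theorem sum_le_blockSum (w : ℕ → ℝ) {n m : ℕ} (hm : m ≤ n) :
    ∑ i ∈ Finset.range (2 ^ n), w i ≤ blockSum w n m := by
  rw [sum_range_two_pow_eq_sum_blocks _ hm]
  exact Finset.sum_le_sum fun j _ => le_abs_self _

/-- On each block g is replaced by its value at the left end: the frozen part sees only the block
sum of w, the rest only the oscillation of g over a block of length T / 2^m. -/
theorem abs_weighted_sum_le {T a M C : ℝ} (hT : 0 < T) (ha : 0 ≤ a) (hC : 0 ≤ C) {g : ℝ → ℝ}
    (hM : ∀ t, 0 ≤ t → t ≤ T → |g t| ≤ M)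
    (hg : ∀ s t, 0 ≤ s → s ≤ t → t ≤ T → |g t - g s| ≤ C * (t - s) ^ a)
    (w : ℕ → ℝ) {n m : ℕ} (hm : m ≤ n) :
    |∑ i ∈ Finset.range (2 ^ n), g (dyadic T n i) * w i| ≤
      M * blockSum w n m + C * (T / 2 ^ m) ^ a * ∑ i ∈ Finset.range (2 ^ n), |w i| := by
  rw [sum_range_two_pow_eq_sum_blocks _ hm, sum_range_two_pow_eq_sum_blocks (fun i => |w i|) hm,
    blockSum, Finset.mul_sum, Finset.mul_sum, ← Finset.sum_add_distrib]
  refine (Finset.abs_sum_le_sum_abs _ _).trans (Finset.sum_le_sum fun j hj => ?_)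
  set N := 2 ^ (n - m) with hN
  have hpow : 2 ^ m * N = 2 ^ n := by rw [hN, ← pow_add, Nat.add_sub_cancel' hm]
  have hjN : j * N + N ≤ 2 ^ n := by
    rw [← hpow, ← Nat.succ_mul]
    exact Nat.mul_le_mul_right _ (Finset.mem_range.1 hj)
  have e : ∑ i ∈ Finset.Ico (j * N) (j * N + N), g (dyadic T n i) * w i =
      g (dyadic T n (j * N)) * ∑ i ∈ Finset.Ico (j * N) (j * N + N), w i +
      ∑ i ∈ Finset.Ico (j * N) (j * N + N), (g (dyadic T n i) - g (dyadic T n (j * N))) * w i := by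
    rw [Finset.mul_sum, ← Finset.sum_add_distrib]
    exact Finset.sum_congr rfl fun i _ => by ring
  rw [e]
  refine (abs_add_le _ _).trans (add_le_add ?_ ?_)
  · rw [abs_mul]
    exact mul_le_mul_of_nonneg_right (hM _ (dyadic_nonneg hT _ _)
      (dyadic_le hT ((Nat.le_add_right _ _).trans hjN))) (abs_nonneg _)
  · rw [Finset.mul_sum]
    refine (Finset.abs_sum_le_sum_abs _ _).trans (Finset.sum_le_sum fun i hi => ?_)
    rw [abs_mul]
    refine mul_le_mul_of_nonneg_right ?_ (abs_nonneg _)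
    rw [Finset.mem_Ico] at hi
    have hmono := dyadic_mono hT n hi.1
    refine (hg _ _ (dyadic_nonneg hT _ _) hmono (dyadic_le hT (hi.2.le.trans hjN))).trans
      (mul_le_mul_of_nonneg_left (Real.rpow_le_rpow (sub_nonneg.2 hmono) ?_ ha) hC)
    have h1 : dyadic T n i ≤ dyadic T n (j * N + N) := dyadic_mono hT n hi.2.le
    have h2 : dyadic T n (j * N + N) - dyadic T n (j * N) = T / 2 ^ m := by
      have : (2 : ℝ) ^ n = 2 ^ m * N := by exact_mod_cast hpow.symm
      have hN0 : (N : ℝ) ≠ 0 := by simp [hN]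
      rw [dyadic_eq, dyadic_eq, this]
      push_cast
      field_simp
      ring
    linarith

theorem weighted_sum_isBigO {T a r κ : ℝ} (hT : 0 < T) (ha : 0 < a) (hr1 : r ≤ 1)
    (hκ : κ ≤ r * a) {w : ℕ → ℕ → ℝ} {C₁ C₂ : ℝ}
    (hblock : ∀ n : ℕ, blockSum (w n) n ⌊r * n⌋₊ ≤ C₁ * (2 : ℝ) ^ (-(κ * n)))
    (habs : ∀ n, ∑ i ∈ Finset.range (2 ^ n), |w n i| ≤ C₂) {g : ℝ → ℝ}
    (hg : TwoParamHolder T a (fun s t => g t - g s)) :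
    (fun n => ∑ i ∈ Finset.range (2 ^ n), g (dyadic T n i) * w n i) =O[atTop]
      fun n : ℕ => (2 : ℝ) ^ (-(κ * n)) := by
  obtain ⟨M, hM, hgM⟩ := hg.exists_norm_le ha.le
  obtain ⟨C, hC, hgC⟩ := hg
  have hC₁ : 0 ≤ C₁ := by
    have := (blockSum_nonneg _ _ _).trans (hblock 0)
    simpa using this
  have hC₂ : 0 ≤ C₂ := (Finset.sum_nonneg fun _ _ => abs_nonneg _).trans (habs 0)
  refine isBigO_two_rpow_of_le (C := M * C₁ + C * (2 * T) ^ a * C₂) (by positivity) le_rfl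
    fun n => ?_
  refine (abs_weighted_sum_le hT ha.le hC hgM hgC (w n) (floor_mul_le hr1 n)).trans ?_
  set m := ⌊r * n⌋₊
  have hm : r * n < m + 1 := Nat.lt_floor_add_one _
  have hstep : (T / 2 ^ m) ^ a ≤ (2 * T) ^ a * (2 : ℝ) ^ (-(κ * n)) := by
    -- The factor 2 pays for the floor, m > r n - 1.
    have h1 : T / 2 ^ m ≤ (2 * T) * (2 : ℝ) ^ (-(r * n)) := by
      have : ((2 : ℝ) ^ m)⁻¹ ≤ 2 * (2 : ℝ) ^ (-(r * n)) := by
        calc ((2 : ℝ) ^ m)⁻¹ = (2 : ℝ) ^ (-(m : ℝ)) := by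
              rw [Real.rpow_neg (by norm_num), Real.rpow_natCast]
          _ ≤ (2 : ℝ) ^ (1 + -(r * n)) :=
              Real.rpow_le_rpow_of_exponent_le (by norm_num) (by linarith)
          _ = _ := by rw [Real.rpow_add (by norm_num), Real.rpow_one]
      rw [div_eq_mul_inv]
      nlinarith
    refine (Real.rpow_le_rpow (by positivity) h1 ha.le).trans ?_
    rw [Real.mul_rpow (by positivity) (by positivity), ← Real.rpow_mul (by norm_num)]
    refine mul_le_mul_of_nonneg_left (Real.rpow_le_rpow_of_exponent_le (by norm_num) ?_)
      (by positivity)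
    have := mul_le_mul_of_nonneg_right hκ (n.cast_nonneg : (0 : ℝ) ≤ n)
    linarith
  calc M * blockSum (w n) n m + C * (T / 2 ^ m) ^ a * ∑ i ∈ Finset.range (2 ^ n), |w n i|
      ≤ M * (C₁ * (2 : ℝ) ^ (-(κ * n))) + C * ((2 * T) ^ a * (2 : ℝ) ^ (-(κ * n))) * C₂ := by
        gcongr
        · exact hblock n
        · exact habs n
    _ = _ := by ring

end WeightedSums

/-! ### Rate of convergence of weighted quadratic covariations -/

section QuadraticCovariation

/-- Along the dyadic partitions of `[0,T]`, the scaled quadratic covariations of the components of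
`b`, weighted by an `a`-Hölder function, converge with rate `2 ^ (-κ n)` to those of a process with
orthonormal components. -/
def HasQVRate {K : ℕ} (T H κ a : ℝ) (b : ℝ → E K) : Prop :=
  ∀ k l, ∀ g : ℝ → ℝ, TwoParamHolder T a (fun s t => g t - g s) →
    (fun n => ∑ i ∈ Finset.range (2 ^ n), g (dyadic T n i) *
      ((T / 2 ^ n) ^ (1 - 2 * H) * ((b (dyadic T n (i + 1)) k - b (dyadic T n i) k) *
        (b (dyadic T n (i + 1)) l - b (dyadic T n i) l)) - if k = l then T / 2 ^ n else 0))
    =O[atTop] fun n : ℕ => (2 : ℝ) ^ (-(κ * n))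

theorem qvDev_weighted_sum_isBigO {T H κ a : ℝ} (hT : 0 < T) (ha : 0 < a)
    (hκ0 : 0 ≤ κ) (hκ : κ ≤ fluctExp H * a) {x : ℝ → ℝ}
    (hx : ∃ C, ∀ n : ℕ, blockSum (qvDev T H x n) n ⌊fluctExp H * n⌋₊ ≤ C * (2 : ℝ) ^ (-(κ * n)))
    {g : ℝ → ℝ} (hg : TwoParamHolder T a (fun s t => g t - g s)) :
    (fun n => ∑ i ∈ Finset.range (2 ^ n), g (dyadic T n i) * qvDev T H x n i) =O[atTop]
      fun n : ℕ => (2 : ℝ) ^ (-(κ * n)) := by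
  obtain ⟨C, hC⟩ := hx
  have hr1 : fluctExp H ≤ 1 := (fluctExp_le_half H).trans (by norm_num)
  have hC0 : 0 ≤ C := by
    have := (blockSum_nonneg _ _ _).trans (hC 0)
    simpa using this
  refine weighted_sum_isBigO hT ha hr1 hκ hC (C₂ := C + 2 * T) (fun n => ?_) hg
  -- A deviation is a square minus h, hence at least -h. Its total variation is thus bounded by its
  -- signed sum, which the block sums control, plus 2T.
  have hterm (i : ℕ) : |qvDev T H x n i| ≤ qvDev T H x n i + 2 * (T / 2 ^ n) := by
    have h1 : 0 < T / 2 ^ n := by positivity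
    have h2 : 0 ≤ (T / 2 ^ n) ^ (1 - 2 * H) * (x (dyadic T n (i + 1)) - x (dyadic T n i)) ^ 2 := by
      positivity
    unfold qvDev
    rw [abs_le]
    constructor <;> linarith
  refine (Finset.sum_le_sum fun i _ => hterm i).trans ?_
  rw [Finset.sum_add_distrib, Finset.sum_const, Finset.card_range, nsmul_eq_mul]
  refine add_le_add ?_ (le_of_eq ?_)
  · refine (sum_le_blockSum _ (floor_mul_le hr1 n)).trans ((hC n).trans ?_)
    refine mul_le_of_le_one_right hC0 (Real.rpow_le_one_of_one_le_of_nonpos (by norm_num) ?_)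
    have : 0 ≤ κ * n := by positivity
    linarith
  · push_cast
    field_simp

/-- Off the diagonal, xy = ((x+y)/√2)² - x²/2 - y²/2, and the three compensators cancel. Randomness
enters only through block sums, so one null set serves all weights g; this matters because the
weights used later depend on the solution and so on ω. -/
theorem FracDiff.IsFBM.ae_hasQVRate {Ω : Type*} [MeasurableSpace Ω] {P : Measure Ω}
    [IsProbabilityMeasure P] {K : ℕ} {T H κ a : ℝ} (hT : 0 < T) (hH0 : 0 < H) (hH1 : H < 1) (ha : 0 < a) (hκ0 : 0 ≤ κ)
    (hκa : κ ≤ fluctExp H * a) (hκH : κ < fluctExp H * H) {B : ℝ → Ω → E K} (hB : IsFBM P H B) :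
    ∀ᵐ ω ∂P, HasQVRate T H κ a (fun t => B t ω) := by
  have hdiag (k : Fin K) : ∀ᵐ ω ∂P, ∃ C, ∀ n : ℕ,
      blockSum (qvDev T H (fun t => B t ω k) n) n ⌊fluctExp H * n⌋₊ ≤ C * (2 : ℝ) ^ (-(κ * n)) := by
    have := (hB.isScalarFBM hH0.ne' (Pi.single k 1) (by
      simp [Pi.single_apply])).ae_blockSum_le hH0.le hH1 hT hκH
    simpa [Pi.single_apply] using this
  have hoff (k l : Fin K) : ∀ᵐ ω ∂P, k ≠ l → ∃ C, ∀ n : ℕ,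
      blockSum (qvDev T H (fun t => (√2)⁻¹ * (B t ω k + B t ω l)) n) n ⌊fluctExp H * n⌋₊ ≤
        C * (2 : ℝ) ^ (-(κ * n)) := by
    by_cases hkl : k = l
    · exact ae_of_all _ fun ω h => absurd hkl h
    have := (hB.isScalarFBM hH0.ne' (fun i => (√2)⁻¹ *
        ((Pi.single k 1 : Fin K → ℝ) i + (Pi.single l 1 : Fin K → ℝ) i)) (by
      have e (i : Fin K) : ((√2)⁻¹ *
          ((Pi.single k 1 : Fin K → ℝ) i + (Pi.single l 1 : Fin K → ℝ) i)) ^ 2 =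
          (1 / 2 : ℝ) * ((Pi.single k 1 : Fin K → ℝ) i + (Pi.single l 1 : Fin K → ℝ) i) := by
        rw [mul_pow, inv_pow, Real.sq_sqrt (by norm_num)]
        by_cases h1 : i = k
        · subst h1; simp [hkl]
        · by_cases h2 : i = l
          · subst h2; simp [h1]
          · simp [h1, h2]
      simp_rw [e]
      rw [← Finset.mul_sum, Finset.sum_add_distrib]
      simp [Pi.single_apply]
      norm_num)).ae_blockSum_le hH0.le hH1 hT hκH
    filter_upwards [this] with ω hω _
    convert! hω using 6 with C n
    funext t
    simp_rw [mul_assoc]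
    rw [← Finset.mul_sum]
    simp [add_mul, Finset.sum_add_distrib, Pi.single_apply]
  filter_upwards [ae_all_iff.2 hdiag, ae_all_iff.2 fun k => ae_all_iff.2 (hoff k)] with ω h1 h2
  intro k l g hg
  have hk := qvDev_weighted_sum_isBigO hT ha hκ0 hκa (h1 k) hg
  have hl := qvDev_weighted_sum_isBigO hT ha hκ0 hκa (h1 l) hg
  by_cases hkl : k = l
  · subst hkl
    refine hk.congr_left fun n => Finset.sum_congr rfl fun i _ => ?_
    rw [if_pos rfl, ← sq]
    rfl
  · have hkl' := qvDev_weighted_sum_isBigO hT ha hκ0 hκa (h2 k l hkl) hg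
    refine ((hkl'.sub (hk.const_mul_left (1 / 2))).sub (hl.const_mul_left (1 / 2))).congr_left
      fun n => ?_
    rw [Finset.mul_sum, Finset.mul_sum, ← Finset.sum_sub_distrib, ← Finset.sum_sub_distrib]
    refine Finset.sum_congr rfl fun i _ => ?_
    rw [if_neg hkl]
    simp only [qvDev]
    rw [← mul_sub, mul_pow, inv_pow, Real.sq_sqrt (by norm_num)]
    ring

theorem abs_dyadic_increment_le {T a C : ℝ} (hT : 0 < T) {F : ℝ → ℝ → ℝ}
    (hF : ∀ s t, 0 ≤ s → s ≤ t → t ≤ T → ‖F s t‖ ≤ C * (t - s) ^ a) {n i : ℕ}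
    (hi : i ∈ Finset.range (2 ^ n)) :
    |F (dyadic T n i) (dyadic T n (i + 1))| ≤ C * (T / 2 ^ n) ^ a := by
  have := hF _ _ (dyadic_nonneg hT n i) (dyadic_mono hT n i.le_succ) (dyadic_succ_le hT hi)
  rwa [dyadic_succ_sub] at this

/-- There are T/h terms of order h^(1-2H+a+c), so the sum is of order h^(a+c-2H). -/
theorem scaled_remainder_sum_isBigO {T H κ a c : ℝ} (hT : 0 < T) (hκ : κ ≤ a + c - 2 * H)
    {F G : ℝ → ℝ → ℝ} (hF : TwoParamHolder T a F) (hG : TwoParamHolder T c G) :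
    (fun n => ∑ i ∈ Finset.range (2 ^ n), (T / 2 ^ n) ^ (1 - 2 * H) *
      (F (dyadic T n i) (dyadic T n (i + 1)) * G (dyadic T n i) (dyadic T n (i + 1)))) =O[atTop]
      fun n : ℕ => (2 : ℝ) ^ (-(κ * n)) := by
  obtain ⟨C, hC, hF⟩ := hF
  obtain ⟨C', hC', hG⟩ := hG
  refine isBigO_two_rpow_of_le (C := T * (C * C' * T ^ (a + c - 2 * H))) (by positivity) hκ
    fun n => ?_
  have hh : 0 < T / 2 ^ n := by positivity
  have hterm (i : ℕ) (hi : i ∈ Finset.range (2 ^ n)) : |(T / 2 ^ n) ^ (1 - 2 * H) *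
      (F (dyadic T n i) (dyadic T n (i + 1)) * G (dyadic T n i) (dyadic T n (i + 1)))| ≤
      C * C' * ((T / 2 ^ n) * (T / 2 ^ n) ^ (a + c - 2 * H)) := by
    rw [abs_mul, abs_mul, abs_of_pos (by positivity : 0 < (T / 2 ^ n) ^ (1 - 2 * H))]
    calc _ ≤ (T / 2 ^ n) ^ (1 - 2 * H) * ((C * (T / 2 ^ n) ^ a) * (C' * (T / 2 ^ n) ^ c)) := by
          gcongr
          · exact abs_dyadic_increment_le hT hF hi
          · exact abs_dyadic_increment_le hT hG hi
      _ = C * C' * ((T / 2 ^ n) ^ (1 - 2 * H) * (T / 2 ^ n) ^ a * (T / 2 ^ n) ^ c) := by ring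
      _ = _ := by
          rw [← Real.rpow_add hh, ← Real.rpow_add hh]
          nth_rewrite 2 [← Real.rpow_one (T / 2 ^ n)]
          rw [← Real.rpow_add hh]
          congr 2; ring
  refine (Finset.abs_sum_le_sum_abs _ _).trans ((Finset.sum_le_sum hterm).trans_eq ?_)
  rw [Finset.sum_const, Finset.card_range, nsmul_eq_mul, step_rpow hT]
  push_cast
  field_simp

theorem scaledQVn_eq {T γ : ℝ} (n : ℕ) (x : ℝ → ℝ) : scaledQVn T γ n x =
    (T / 2 ^ n) ^ γ * ∑ i ∈ Finset.range (2 ^ n),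
      (x (dyadic T n (i + 1)) - x (dyadic T n i)) ^ 2 := by
  unfold scaledQVn
  rw [Finset.mul_sum]
  simp_rw [dyadic_succ_sub]

/-- Scaled quadratic variation of a path that is controlled by `b`. -/
theorem scaledQVn_sub_riemannSum_isBigO {K : ℕ} {T H κ a c : ℝ} (hT : 0 < T) (ha : 0 < a)
    (hac : a ≤ c) (hκ : κ ≤ a + c - 2 * H) {b : ℝ → E K}
    (hb : TwoParamHolder T a (fun s t => b t - b s)) (hqv : HasQVRate T H κ a b)
    {g : Fin K → ℝ → ℝ} (hg : ∀ k, TwoParamHolder T a (fun s t => g k t - g k s)) {x : ℝ → ℝ}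
    (hx : TwoParamHolder T c (fun s t => x t - x s - ∑ k, g k s * (b t k - b s k))) :
    (fun n => scaledQVn T (1 - 2 * H) n x -
      ∑ k, ∑ i ∈ Finset.range (2 ^ n), g k (dyadic T n i) ^ 2 * (T / 2 ^ n)) =O[atTop]
      fun n : ℕ => (2 : ℝ) ^ (-(κ * n)) := by
  have hL : TwoParamHolder T a (fun s t => ∑ k, g k s * (b t k - b s k)) := by
    refine TwoParamHolder.sum _ fun k _ => ?_
    obtain ⟨M, hM, hgM⟩ := (hg k).exists_norm_le ha.le
    refine hb.of_norm_le hM fun s t hs hst ht => ?_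
    rw [norm_mul]
    exact mul_le_mul (hgM s hs (hst.trans ht)) (PiLp.norm_apply_le (b t - b s) k) (norm_nonneg _) hM
  -- With L the linear part and R the remainder, (L + R)² - L² = R (R + 2L): one factor is of order
  -- c, the other of order a.
  have hS : TwoParamHolder T a (fun s t => x t - x s - ∑ k, g k s * (b t k - b s k) +
      2 * ∑ k, g k s * (b t k - b s k)) :=
    (hx.mono_exponent ha hac).add (hL.of_norm_le (M := 2) (by norm_num) fun s t _ _ _ => by
      rw [norm_mul]; norm_num)
  have hrem := scaled_remainder_sum_isBigO hT (H := H) (κ := κ) (by linarith) hx hS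
  -- Expanding L² gives covariations with weights g_k g_l, again a-Hölder; the compensators on the
  -- diagonal k = l produce the Riemann sums.
  have hmain : (fun n => ∑ k, ∑ l, ∑ i ∈ Finset.range (2 ^ n),
      (g k (dyadic T n i) * g l (dyadic T n i)) *
      ((T / 2 ^ n) ^ (1 - 2 * H) * ((b (dyadic T n (i + 1)) k - b (dyadic T n i) k) *
        (b (dyadic T n (i + 1)) l - b (dyadic T n i) l)) - if k = l then T / 2 ^ n else 0))
      =O[atTop] fun n : ℕ => (2 : ℝ) ^ (-(κ * n)) :=
    Asymptotics.IsBigO.fun_sum fun k _ => Asymptotics.IsBigO.fun_sum fun l _ =>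
      hqv k l (fun t => g k t * g l t) ((hg k).mul ha.le (hg l))
  refine (hrem.add hmain).congr_left fun n => ?_
  rw [scaledQVn_eq, Finset.sum_comm (s := Finset.univ) (t := Finset.range (2 ^ n))]
  simp_rw [Finset.sum_comm (s := Finset.univ) (t := Finset.range (2 ^ n))]
  rw [Finset.mul_sum, ← Finset.sum_add_distrib, ← Finset.sum_sub_distrib]
  refine Finset.sum_congr rfl fun i _ => ?_
  have e1 : ∑ k, ∑ l, (g k (dyadic T n i) * g l (dyadic T n i)) *
      ((T / 2 ^ n) ^ (1 - 2 * H) * ((b (dyadic T n (i + 1)) k - b (dyadic T n i) k) *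
        (b (dyadic T n (i + 1)) l - b (dyadic T n i) l)) - if k = l then T / 2 ^ n else 0) =
      (T / 2 ^ n) ^ (1 - 2 * H) *
        (∑ k, g k (dyadic T n i) * (b (dyadic T n (i + 1)) k - b (dyadic T n i) k)) ^ 2 -
      ∑ k, g k (dyadic T n i) ^ 2 * (T / 2 ^ n) := by
    rw [sq (∑ k, _), Finset.sum_mul_sum, Finset.mul_sum, ← Finset.sum_sub_distrib]
    refine Finset.sum_congr rfl fun k _ => ?_
    have e (l : Fin K) : (g k (dyadic T n i) * g l (dyadic T n i)) *
        ((T / 2 ^ n) ^ (1 - 2 * H) * ((b (dyadic T n (i + 1)) k - b (dyadic T n i) k) *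
          (b (dyadic T n (i + 1)) l - b (dyadic T n i) l)) - if k = l then T / 2 ^ n else 0) =
        (T / 2 ^ n) ^ (1 - 2 * H) *
          (g k (dyadic T n i) * (b (dyadic T n (i + 1)) k - b (dyadic T n i) k) *
          (g l (dyadic T n i) * (b (dyadic T n (i + 1)) l - b (dyadic T n i) l))) -
        if k = l then g k (dyadic T n i) ^ 2 * (T / 2 ^ n) else 0 := by
      split_ifs with h
      · subst h; ring
      · ring
    simp_rw [e]
    rw [Finset.sum_sub_distrib, Finset.sum_ite_eq, if_pos (Finset.mem_univ k), Finset.mul_sum]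
  rw [e1]
  ring

theorem scaledQVn_sub_integral_isBigO {K : ℕ} {T H κ a c : ℝ} (hT : 0 < T) (ha : 0 < a)
    (hac : a ≤ c) (hκ : κ ≤ a + c - 2 * H) (hκa : κ ≤ a) {b : ℝ → E K}
    (hb : TwoParamHolder T a (fun s t => b t - b s)) (hqv : HasQVRate T H κ a b)
    {g : Fin K → ℝ → ℝ} (hg : ∀ k, TwoParamHolder T a (fun s t => g k t - g k s)) {x : ℝ → ℝ}
    (hx : TwoParamHolder T c (fun s t => x t - x s - ∑ k, g k s * (b t k - b s k))) :
    (fun n => scaledQVn T (1 - 2 * H) n x - ∑ k, ∫ t in (0 : ℝ)..T, g k t ^ 2) =O[atTop]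
      fun n : ℕ => (2 : ℝ) ^ (-(κ * n)) := by
  have h1 := scaledQVn_sub_riemannSum_isBigO hT ha hac hκ hb hqv hg hx
  have h2 : (fun n => ∑ k, (∑ i ∈ Finset.range (2 ^ n), g k (dyadic T n i) ^ 2 * (T / 2 ^ n) -
      ∫ t in (0 : ℝ)..T, g k t ^ 2)) =O[atTop] fun n : ℕ => (2 : ℝ) ^ (-(κ * n)) :=
    Asymptotics.IsBigO.fun_sum fun k _ => (riemannSum_sub_integral_isBigO hT ha
      (g := fun t => g k t ^ 2) (((hg k).mul ha.le (hg k)).congr fun s t _ _ _ => by ring)).trans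
      (isBigO_two_rpow_of_le zero_le_one hκa fun n => by rw [abs_of_pos (by positivity), one_mul])
  refine (h1.add h2).congr_left fun n => ?_
  rw [Finset.sum_sub_distrib]
  ring

end QuadraticCovariation

/-! ### Functions of solutions -/

section ChainRule

theorem ContDiff.exists_lipschitz_closedBall {d : ℕ} {W : Type*} [NormedAddCommGroup W]
    [NormedSpace ℝ W] {F : E d → W} (hF : ContDiff ℝ 1 F) (M : ℝ) :
    ∃ C, 0 ≤ C ∧ ∀ x y, ‖x‖ ≤ M → ‖y‖ ≤ M → ‖F y - F x‖ ≤ C * ‖y - x‖ := by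
  obtain ⟨C, hC⟩ := hF.contDiffOn.exists_lipschitzOnWith one_ne_zero
    (convex_closedBall (0 : E d) M) (isCompact_closedBall 0 M)
  refine ⟨C, C.2, fun x y hx hy => ?_⟩
  exact hC.norm_sub_le (by simpa using hy) (by simpa using hx)

theorem TwoParamHolder.comp_contDiff {d : ℕ} {W : Type*} [NormedAddCommGroup W] [NormedSpace ℝ W]
    {T a : ℝ} (ha : 0 ≤ a) {F : E d → W} (hF : ContDiff ℝ 1 F) {y : ℝ → E d}
    (hy : TwoParamHolder T a (fun s t => y t - y s)) :
    TwoParamHolder T a (fun s t => F (y t) - F (y s)) := by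
  obtain ⟨M, hM, hyM⟩ := hy.exists_norm_le ha
  obtain ⟨C, hC, hCb⟩ := ContDiff.exists_lipschitz_closedBall hF M
  exact hy.of_norm_le hC fun s t hs hst ht =>
    hCb _ _ (hyM s hs (hst.trans ht)) (hyM t (hs.trans hst) ht)

theorem ContDiff.exists_taylor_closedBall {d : ℕ} {f : E d → ℝ} (hf : ContDiff ℝ 2 f) (M : ℝ) :
    ∃ C, 0 ≤ C ∧ ∀ x y, ‖x‖ ≤ M → ‖y‖ ≤ M →
      |f y - f x - fderiv ℝ f x (y - x)| ≤ C * ‖y - x‖ ^ 2 := by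
  obtain ⟨C, hC, hCb⟩ := ContDiff.exists_lipschitz_closedBall
    (hf.fderiv_right (m := 1) (by norm_num)) M
  refine ⟨C, hC, fun x y hx hy => ?_⟩
  have hseg := (convex_closedBall (0 : E d) M).segment_subset
    (show x ∈ Metric.closedBall 0 M by simpa using hx)
    (show y ∈ Metric.closedBall 0 M by simpa using hy)
  have := (convex_segment x y).norm_image_sub_le_of_norm_fderiv_le' (𝕜 := ℝ) (f := f)
    (φ := fderiv ℝ f x) (C := C * ‖y - x‖)
    (fun z _ => (hf.differentiable (by norm_num)).differentiableAt) (fun z hz => by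
      refine (hCb x z hx (by simpa using hseg hz)).trans ?_
      exact mul_le_mul_of_nonneg_left (norm_sub_le_of_mem_segment hz) hC)
    (left_mem_segment ℝ x y) (right_mem_segment ℝ x y)
  rw [← Real.norm_eq_abs, sq, ← mul_assoc]
  exact this

theorem contDiff_act {d : ℕ} {σ : E d → E d} (hσ : ContDiff ℝ 1 σ) {f : E d → ℝ}
    (hf : ContDiff ℝ 2 f) : ContDiff ℝ 1 (act σ f) :=
  (hf.fderiv_right (m := 1) (by norm_num)).clm_apply hσ

/-- The path stays in a ball, so u is bounded along it by compactness. This Lipschitz term is why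
remainders below have order min(2a, 1) rather than 2a. -/
theorem TwoParamHolder.integral_drift {d : ℕ} {T a : ℝ} (ha : 0 < a) {u : ℝ → E d → E d}
    (hu : ContinuousOn (fun p : ℝ × E d => u p.1 p.2) (Icc 0 T ×ˢ univ)) {y : ℝ → E d}
    (hy : TwoParamHolder T a (fun s t => y t - y s)) :
    TwoParamHolder T 1 (fun s t => ∫ r in s..t, u r (y r)) := by
  obtain ⟨M, hM, hyM⟩ := hy.exists_norm_le ha.le
  obtain ⟨C, hC⟩ := (isCompact_Icc.prod
    (isCompact_closedBall (0 : E d) M)).exists_bound_of_continuousOn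
    (hu.mono (prod_mono_right (subset_univ _)))
  refine ⟨|C|, abs_nonneg C, fun s t hs hst ht => ?_⟩
  rw [Real.rpow_one, ← abs_of_nonneg (sub_nonneg.2 hst)]
  refine intervalIntegral.norm_integral_le_of_norm_le_const fun r hr => ?_
  rw [uIoc_of_le hst] at hr
  have h0 : 0 ≤ r := hs.trans hr.1.le
  have h1 : r ≤ T := hr.2.trans ht
  exact (hC (r, y r) ⟨⟨h0, h1⟩, by simpa using hyM r h0 h1⟩).trans (le_abs_self C)

/-- A `C²` function of a solution is controlled by the driving path. -/
theorem TwoParamHolder.comp_solution {d K : ℕ} {T a : ℝ} (ha : 0 < a) {z : ℝ → E K}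
    {u : ℝ → E d → E d} (hu : ContinuousOn (fun p : ℝ × E d => u p.1 p.2) (Icc 0 T ×ˢ univ))
    {V : Fin K → E d → E d} {y : ℝ → E d} (hy : TwoParamHolder T a (fun s t => y t - y s))
    (hsharp : TwoParamHolder T (2 * a) (fun s t =>
      y t - y s - (∫ r in s..t, u r (y r)) - ∑ k, (z t k - z s k) • V k (y s)))
    {f : E d → ℝ} (hf : ContDiff ℝ 2 f) :
    TwoParamHolder T (min (2 * a) 1) (fun s t =>
      f (y t) - f (y s) - ∑ k, act (V k) f (y s) * (z t k - z s k)) := by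
  have hmin : 0 < min (2 * a) 1 := lt_min (by linarith) one_pos
  obtain ⟨M, hM, hyM⟩ := hy.exists_norm_le ha.le
  have hD : TwoParamHolder T a (fun s t => fderiv ℝ f (y t) - fderiv ℝ f (y s)) :=
    hy.comp_contDiff ha.le (hf.fderiv_right (m := 1) (by norm_num))
  obtain ⟨M', hM', hDM⟩ := TwoParamHolder.exists_norm_le (x := fun t => fderiv ℝ f (y t)) ha.le hD
  obtain ⟨C, hC, hCb⟩ := ContDiff.exists_taylor_closedBall hf M
  have h1 : TwoParamHolder T (2 * a)
      (fun s t => f (y t) - f (y s) - fderiv ℝ f (y s) (y t - y s)) := by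
    obtain ⟨C', hC', hyC⟩ := hy
    refine ⟨C * C' ^ 2, by positivity, fun s t hs hst ht => ?_⟩
    refine (hCb _ _ (hyM s hs (hst.trans ht)) (hyM t (hs.trans hst) ht)).trans ?_
    have h0 := sub_nonneg.2 hst
    rw [mul_assoc, mul_comm 2 a, Real.rpow_mul h0, Real.rpow_two, ← mul_pow]
    gcongr
    exact hyC s t hs hst ht
  have h2 := (hy.integral_drift ha hu).mono_exponent hmin (min_le_right _ _)
  -- Drift plus remainder is the increment of y minus its linear part in z; applying the bounded
  -- derivative of f to it completes the first-order expansion.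
  have h3 := (h2.add (hsharp.mono_exponent hmin (min_le_left _ _))).of_norm_le hM'
    (G := fun s t => fderiv ℝ f (y s) ((∫ r in s..t, u r (y r)) + (y t - y s -
      (∫ r in s..t, u r (y r)) - ∑ k, (z t k - z s k) • V k (y s)))) fun s t hs hst ht =>
    ((fderiv ℝ f (y s)).le_opNorm _).trans
      (mul_le_mul_of_nonneg_right (hDM s hs (hst.trans ht)) (norm_nonneg _))
  refine ((h1.mono_exponent hmin (min_le_left _ _)).add h3).congr fun s t _ _ _ => ?_
  have e : (∫ r in s..t, u r (y r)) + (y t - y s -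
      (∫ r in s..t, u r (y r)) - ∑ k, (z t k - z s k) • V k (y s)) =
      (y t - y s) - ∑ k, (z t k - z s k) • V k (y s) := by abel
  rw [e, map_sub (fderiv ℝ f (y s)) (y t - y s) (∑ k, _), map_sum]
  simp only [map_smul, smul_eq_mul, act]
  simp_rw [mul_comm (z t _ - z s _)]
  ring

end ChainRule

/-! ### Exponents and rates -/

section Rates

theorem tendsto_two_rpow_neg_mul {κ : ℝ} (hκ : 0 < κ) :
    Tendsto (fun n : ℕ => (2 : ℝ) ^ (-(κ * n))) atTop (𝓝 0) := by
  have h := tendsto_pow_atTop_nhds_zero_of_lt_one (r := (2 : ℝ) ^ (-κ)) (by positivity)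
    (Real.rpow_lt_one_of_one_lt_of_neg (by norm_num) (by linarith))
  refine h.congr fun n => ?_
  rw [← Real.rpow_natCast, ← Real.rpow_mul (by norm_num)]
  congr 1; ring

theorem tendsto_mul_two_rpow_neg_mul {κ : ℝ} (hκ : 0 < κ) :
    Tendsto (fun n : ℕ => (n : ℝ) * (2 : ℝ) ^ (-(κ * n))) atTop (𝓝 0) := by
  have h := tendsto_self_mul_const_pow_of_lt_one (r := (2 : ℝ) ^ (-κ)) (by positivity)
    (Real.rpow_lt_one_of_one_lt_of_neg (by norm_num) (by linarith))
  refine h.congr fun n => ?_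
  rw [← Real.rpow_natCast, ← Real.rpow_mul (by norm_num)]
  congr 2; ring

theorem rate_eq (H : ℝ) (n : ℕ) : rate H n = (2 : ℝ) ^ (-(fluctExp H * n)) * √n := by
  unfold rate fluctExp
  split_ifs <;> congr 2 <;> ring

theorem eventually_rate_le_one {H : ℝ} (hH1 : H < 1) : ∀ᶠ n : ℕ in atTop, rate H n ≤ 1 := by
  have h := tendsto_mul_two_rpow_neg_mul (mul_pos two_pos (fluctExp_pos hH1))
  filter_upwards [h.eventually_le_const one_pos] with n hn
  have h0 : 0 ≤ rate H n := by rw [rate_eq]; positivity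
  have : rate H n ^ 2 = (n : ℝ) * (2 : ℝ) ^ (-(2 * fluctExp H * n)) := by
    rw [rate_eq, mul_pow, Real.sq_sqrt n.cast_nonneg, ← Real.rpow_natCast (_ ^ _) 2,
      ← Real.rpow_mul (by norm_num), mul_comm]
    congr 2
    push_cast
    ring
  nlinarith

/-- The factor √n only enlarges the rate, and δ ≤ H permits monotonicity in the base. Once the rate
is at most 1, lowering the exponent from H - δ to H - ε enlarges it further, even if H - ε is
negative. -/
theorem isLittleO_rate {H ε κ δ : ℝ} (hH1 : H < 1) (hδε : δ ≤ ε) (hδH : δ ≤ H)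
    (hκ : fluctExp H * (H - δ) < κ) :
    (fun n : ℕ => (n : ℝ) * (2 : ℝ) ^ (-(κ * n))) =o[atTop]
      fun n : ℕ => (n : ℝ) * rate H n ^ (H - ε) := by
  refine Asymptotics.IsLittleO.of_bound fun c hc => ?_
  have h := tendsto_two_rpow_neg_mul (sub_pos.2 hκ)
  filter_upwards [h.eventually_le_const hc, eventually_rate_le_one hH1, eventually_ge_atTop 1]
    with n hn hr h1
  have hs : (1 : ℝ) ≤ √n := Real.one_le_sqrt.2 (by exact_mod_cast h1)
  have hbase : (2 : ℝ) ^ (-(fluctExp H * n)) ≤ rate H n := by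
    rw [rate_eq]
    exact le_mul_of_one_le_right (by positivity) hs
  have hpos : 0 < rate H n := lt_of_lt_of_le (by positivity) hbase
  have hle : (2 : ℝ) ^ (-(fluctExp H * (H - δ) * n)) ≤ rate H n ^ (H - ε) := by
    calc (2 : ℝ) ^ (-(fluctExp H * (H - δ) * n))
        = ((2 : ℝ) ^ (-(fluctExp H * n))) ^ (H - δ) := by
          rw [← Real.rpow_mul (by norm_num)]; congr 1; ring
      _ ≤ rate H n ^ (H - δ) := Real.rpow_le_rpow (by positivity) hbase (by linarith)
      _ ≤ rate H n ^ (H - ε) := Real.rpow_le_rpow_of_exponent_ge hpos hr (by linarith)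
  rw [Real.norm_of_nonneg (by positivity), Real.norm_of_nonneg (by positivity)]
  have e : (2 : ℝ) ^ (-(κ * n)) = (2 : ℝ) ^ (-((κ - fluctExp H * (H - δ)) * n)) *
      (2 : ℝ) ^ (-(fluctExp H * (H - δ) * n)) := by
    rw [← Real.rpow_add (by norm_num)]; congr 1; ring
  calc (n : ℝ) * (2 : ℝ) ^ (-(κ * n)) ≤ n * (c * rate H n ^ (H - ε)) := by
        rw [e]; gcongr
    _ = _ := by ring

/-- κ lies strictly between r(H - δ) and rH, with r = `fluctExp H`; capping δ at H/2 keeps it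
positive for large ε. All conditions on a are lower bounds strictly below H: the remainder condition
needs κ < H when H ≤ 1/2, and κ < 1 - H when H > 1/2. -/
theorem exists_exponents {H ε : ℝ} (hH : 1 / 3 < H) (hH1 : H < 1) (hε : 0 < ε) :
    ∃ κ a δ : ℝ, 0 < κ ∧ κ < fluctExp H * H ∧ 1 / 3 < a ∧ a < H ∧ (1 / 2 < H → 1 / 2 < a) ∧
      κ ≤ fluctExp H * a ∧ κ ≤ a + min (2 * a) 1 - 2 * H ∧ δ ≤ ε ∧ δ ≤ H ∧
      fluctExp H * (H - δ) < κ := by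
  have hr := fluctExp_pos hH1
  have hr2 := fluctExp_le_half H
  have hδ : 0 < min ε (H / 2) := lt_min hε (by linarith)
  have hδ1 := min_le_left ε (H / 2)
  have hδ2 := min_le_right ε (H / 2)
  set δ := min ε (H / 2)
  obtain ⟨κ, hκ⟩ : ∃ κ, κ = fluctExp H * (H - δ / 2) := ⟨_, rfl⟩
  have hκ0 : 0 < κ := by rw [hκ]; exact mul_pos hr (by linarith)
  have hκH : κ < fluctExp H * H := by rw [hκ]; exact mul_lt_mul_of_pos_left (by linarith) hr
  have hκδ : fluctExp H * (H - δ) < κ := by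
    rw [hκ]; exact mul_lt_mul_of_pos_left (by linarith) hr
  have hκH2 : κ < H := by nlinarith
  suffices ∃ a, 1 / 3 < a ∧ a < H ∧ (1 / 2 < H → 1 / 2 < a) ∧ H - δ / 2 < a ∧
      κ ≤ a + min (2 * a) 1 - 2 * H by
    obtain ⟨a, h1, h2, h3, h4, h5⟩ := this
    refine ⟨κ, a, δ, hκ0, hκH, h1, h2, h3, ?_, h5, hδ1, by linarith, hκδ⟩
    rw [hκ]
    exact mul_le_mul_of_nonneg_left h4.le hr.le
  by_cases hH2 : H ≤ 1 / 2
  · obtain ⟨a, ha, haH⟩ := exists_between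
      (max_lt hH (max_lt (by linarith : H - δ / 2 < H) (by linarith : (2 * H + κ) / 3 < H)))
    rw [max_lt_iff, max_lt_iff] at ha
    refine ⟨a, ha.1, haH, fun h => by linarith, ha.2.1, ?_⟩
    rw [min_eq_left (by linarith)]
    linarith
  · have hκ1 : κ < 1 - H := by
      have : fluctExp H = 1 - H := if_neg hH2
      rw [this] at hκH
      nlinarith
    obtain ⟨a, ha, haH⟩ := exists_between (max_lt (not_le.1 hH2)
      (max_lt (by linarith : H - δ / 2 < H) (by linarith : κ + 2 * H - 1 < H)))
    rw [max_lt_iff, max_lt_iff] at ha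
    refine ⟨a, by linarith, haH, fun _ => ha.1, ha.2.1, ?_⟩
    rw [min_eq_right (by linarith)]
    linarith

end Rates

/-! ### Least squares with perturbed data -/

section LeastSquares

theorem norm_toLp_mulVec_le {K M : ℕ} (A : Matrix (Fin M) (Fin K) ℝ) (v : E K) :
    ‖(WithLp.toLp 2 (A *ᵥ v.ofLp) : E M)‖ ≤ (∑ i, ∑ j, |A i j|) * ‖v‖ := by
  have e : (WithLp.toLp 2 (A *ᵥ v.ofLp) : E M) =
      ∑ i, EuclideanSpace.single i ((A *ᵥ v.ofLp) i) := by
    ext i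
    simp [Pi.single_apply]
  rw [e, Finset.sum_mul]
  refine (norm_sum_le _ _).trans (Finset.sum_le_sum fun i _ => ?_)
  rw [PiLp.norm_single, Matrix.mulVec, dotProduct, Finset.sum_mul]
  refine (norm_sum_le _ _).trans (Finset.sum_le_sum fun j _ => ?_)
  rw [norm_mul]
  exact mul_le_mul_of_nonneg_left (PiLp.norm_apply_le v j) (norm_nonneg _)

theorem exists_le_norm_mulVec {K M : ℕ} {A : Matrix (Fin M) (Fin K) ℝ}
    (hA : LinearIndependent ℝ A.col) :
    ∃ c, 0 < c ∧ ∀ v : E K, c * ‖v‖ ≤ ‖(WithLp.toLp 2 (A *ᵥ v.ofLp) : E M)‖ := by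
  let L : E K →ₗ[ℝ] E M := Matrix.toLpLin 2 2 A
  have hL (v : E K) : L v = WithLp.toLp 2 (A *ᵥ v.ofLp) := rfl
  have hinj : Function.Injective L := by
    intro v w hvw
    rw [hL, hL] at hvw
    have := Matrix.mulVec_injective_iff.2 hA (WithLp.toLp_injective 2 hvw)
    exact WithLp.ofLp_injective 2 this
  obtain ⟨C, hC, hanti⟩ := LinearMap.exists_antilipschitzWith L (LinearMap.ker_eq_bot.2 hinj)
  refine ⟨(C : ℝ)⁻¹, by positivity, fun v => ?_⟩
  have := hanti.le_mul_dist v 0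
  rw [dist_zero_right, map_zero, dist_zero_right, hL] at this
  rwa [inv_mul_le_iff₀ (by exact_mod_cast hC)]

/-- The minimiser's residual is no larger than that of β, so An (β - b n) is at most twice the
latter. The limit A is bounded below by some c > 0 and An eventually by c/2, whence the constant
4/c. -/
theorem leastSquares_sub_isBigO {K M : ℕ} {A : Matrix (Fin M) (Fin K) ℝ}
    (hA : LinearIndependent ℝ A.col) {An : ℕ → Matrix (Fin M) (Fin K) ℝ}
    (hAn : ∀ i j, Tendsto (fun n => An n i j) atTop (𝓝 (A i j))) {Yn : ℕ → E M} {β : E K}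
    {e : ℕ → ℝ}
    (hY : ∀ i, (fun n => Yn n i - ∑ j, An n i j * β j) =O[atTop] e) {b : ℕ → E K}
    (hb : ∀ n, IsLeastSquares (An n) (Yn n) (b n)) :
    (fun n => β - b n) =O[atTop] e := by
  obtain ⟨c, hc, hcA⟩ := exists_le_norm_mulVec hA
  have hlim : Tendsto (fun n => ∑ i, ∑ j, |An n i j - A i j|) atTop (𝓝 0) := by
    have : Tendsto (fun n => ∑ i, ∑ j, |An n i j - A i j|) atTop
        (𝓝 (∑ i : Fin M, ∑ j : Fin K, |A i j - A i j|)) :=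
      tendsto_finsetSum _ fun i _ => tendsto_finsetSum _ fun j _ => ((hAn i j).sub_const _).abs
    simpa using this
  have hres : (fun n => Yn n - WithLp.toLp 2 (An n *ᵥ β.ofLp)) =O[atTop] e := by
    have hsum : (fun n => ∑ i, ‖Yn n i - ∑ j, An n i j * β j‖) =O[atTop] e :=
      Asymptotics.IsBigO.fun_sum fun i _ => (hY i).norm_left
    refine Asymptotics.IsBigO.trans (Asymptotics.IsBigO.of_bound 1
      (Eventually.of_forall fun n => ?_)) hsum
    rw [one_mul, Real.norm_of_nonneg (Finset.sum_nonneg fun _ _ => norm_nonneg _)]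
    have e1 : Yn n - WithLp.toLp 2 (An n *ᵥ β.ofLp) =
        ∑ i, EuclideanSpace.single i (Yn n i - ∑ j, An n i j * β j) := by
      ext i
      simp [Pi.single_apply, Matrix.mulVec, dotProduct]
    rw [e1]
    exact (norm_sum_le _ _).trans_eq (by simp_rw [PiLp.norm_single])
  refine Asymptotics.IsBigO.trans ?_ hres
  refine Asymptotics.IsBigO.of_bound (4 / c) ?_
  filter_upwards [hlim.eventually_le_const (half_pos hc)] with n hn
  have h1 := hcA (β - b n)
  have h2 := norm_toLp_mulVec_le (An n - A) (β - b n)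
  have h3 := hb n β
  have e2 : (WithLp.toLp 2 (A *ᵥ (β - b n).ofLp) : E M) =
      (Yn n - WithLp.toLp 2 (An n *ᵥ (b n).ofLp)) - (Yn n - WithLp.toLp 2 (An n *ᵥ β.ofLp)) -
      WithLp.toLp 2 ((An n - A) *ᵥ (β - b n).ofLp) := by
    rw [Matrix.sub_mulVec, WithLp.ofLp_sub, Matrix.mulVec_sub, Matrix.mulVec_sub]
    simp only [WithLp.toLp_sub]
    abel
  rw [e2] at h1
  have h4 := norm_sub_le ((Yn n - WithLp.toLp 2 (An n *ᵥ (b n).ofLp)) -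
    (Yn n - WithLp.toLp 2 (An n *ᵥ β.ofLp))) (WithLp.toLp 2 ((An n - A) *ᵥ (β - b n).ofLp))
  have h5 := norm_sub_le (Yn n - WithLp.toLp 2 (An n *ᵥ (b n).ofLp))
    (Yn n - WithLp.toLp 2 (An n *ᵥ β.ofLp))
  have h6 : (∑ i, ∑ j, |(An n - A) i j|) * ‖β - b n‖ ≤ c / 2 * ‖β - b n‖ :=
    mul_le_mul_of_nonneg_right hn (norm_nonneg _)
  rw [div_mul_eq_mul_div, le_div_iff₀ hc]
  linarith

/-- For b ≥ 0 factor θ² - b and use θ + √b ≥ θ; for b ≤ 0 the root is 0 and θ² ≤ θ² - b. -/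
theorem abs_sqrt_sub_le {θ b : ℝ} (hθ : 0 < θ) : |θ - √b| ≤ θ⁻¹ * |θ ^ 2 - b| := by
  rw [inv_mul_eq_div, le_div_iff₀ hθ]
  rcases le_total 0 b with hb | hb
  · have hs := Real.sqrt_nonneg b
    have e : θ ^ 2 - b = (θ - √b) * (θ + √b) := by
      ring_nf; rw [Real.sq_sqrt hb]
    rw [e, abs_mul, abs_of_pos (by linarith : 0 < θ + √b)]
    exact mul_le_mul_of_nonneg_left (by linarith) (abs_nonneg _)
  · rw [Real.sqrt_eq_zero_of_nonpos hb, sub_zero, abs_of_pos hθ, abs_of_nonneg (by nlinarith)]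
    nlinarith

end LeastSquares

/-! ### The estimators along a solution -/

section Estimators

theorem log_sub_log_isBigO {q : ℕ → ℝ} {Q : ℝ} (hQ : Q ≠ 0) {e : ℕ → ℝ}
    (he : Tendsto e atTop (𝓝 0)) (h : (fun n => q n - Q) =O[atTop] e) :
    (fun n => Real.log (q n) - Real.log Q) =O[atTop] e := by
  have hq : Tendsto q atTop (𝓝 Q) := by
    have := (h.trans_tendsto he).add_const Q
    simpa using this
  exact ((Real.hasDerivAt_log hQ).isBigO_sub.comp_tendsto hq).trans h

theorem exp_sub_one_isBigO {x e : ℕ → ℝ} (he : Tendsto e atTop (𝓝 0)) (h : x =O[atTop] e) :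
    (fun n => Real.exp (x n) - 1) =O[atTop] e := by
  have := (Real.hasDerivAt_exp 0).isBigO_sub.comp_tendsto (h.trans_tendsto he)
  simp only [Function.comp_def, Real.exp_zero, sub_zero] at this
  exact this.trans h

variable {d K M : ℕ} {T H κ : ℝ}

theorem scaledQVnVec_eq (hT : 0 < T) (γ : ℝ) (n : ℕ) (y : ℝ → E d) :
    scaledQVnVec T 0 n y = (T / 2 ^ n) ^ (-γ) * scaledQVnVec T γ n y := by
  have hh : 0 < T / 2 ^ n := by positivity
  unfold scaledQVnVec
  rw [Finset.mul_sum]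
  refine Finset.sum_congr rfl fun j _ => ?_
  rw [scaledQVn_eq, scaledQVn_eq, ← mul_assoc, ← Real.rpow_add hh, neg_add_cancel]

/-- With q_n the scaled variation, S_n = 2^(1-2H) q_(n+1)/q_n, so H - H_n = (log q_(n+1) - log
q_n)/(2 log 2). Positivity of Q makes the logarithm differentiable at the limit. -/
theorem hurstEst_sub_isBigO (hT : 0 < T) (hκ : 0 < κ) {y : ℝ → E d} {Q : ℝ} (hQ : 0 < Q)
    (h : (fun n => scaledQVnVec T (1 - 2 * H) n y - Q) =O[atTop]
      fun n : ℕ => (2 : ℝ) ^ (-(κ * n))) :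
    (fun n => H - hurstEst T y n) =O[atTop] fun n : ℕ => (2 : ℝ) ^ (-(κ * n)) := by
  have hlog := log_sub_log_isBigO hQ.ne' (tendsto_two_rpow_neg_mul hκ) h
  have hshift : (fun n : ℕ => (2 : ℝ) ^ (-(κ * (n + 1 : ℕ)))) =O[atTop]
      fun n : ℕ => (2 : ℝ) ^ (-(κ * n)) := by
    refine isBigO_two_rpow_of_le zero_le_one le_rfl fun n => ?_
    rw [abs_of_pos (by positivity), one_mul]
    refine Real.rpow_le_rpow_of_exponent_le (by norm_num) ?_
    push_cast
    linarith
  have hlog' := (hlog.comp_tendsto (tendsto_add_atTop_nat 1)).trans hshift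
  have hq : Tendsto (fun n => scaledQVnVec T (1 - 2 * H) n y) atTop (𝓝 Q) := by
    have := (h.trans_tendsto (tendsto_two_rpow_neg_mul hκ)).add_const Q
    simpa using this
  have hpos := hq.eventually_const_lt hQ
  have hpos' := (tendsto_add_atTop_nat 1).eventually hpos
  refine ((hlog'.sub hlog).const_mul_left (1 / (2 * Real.log 2))).congr' ?_ EventuallyEq.rfl
  filter_upwards [hpos, hpos'] with n h1 h2
  have hl2 : Real.log 2 ≠ 0 := (Real.log_pos (by norm_num)).ne'
  have hh : 0 < T / 2 ^ n := by positivity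
  have hh' : 0 < T / 2 ^ (n + 1) := by positivity
  have hstep : Real.log (T / 2 ^ (n + 1)) = Real.log (T / 2 ^ n) - Real.log 2 := by
    rw [pow_succ, ← div_div, Real.log_div hh.ne' two_ne_zero]
  unfold hurstEst
  rw [scaledQVnVec_eq hT (1 - 2 * H), scaledQVnVec_eq hT (1 - 2 * H) n,
    Real.log_div (by positivity) (by positivity), Real.log_mul (by positivity) h2.ne',
    Real.log_mul (by positivity) h1.ne', Real.log_rpow hh, Real.log_rpow hh', hstep]
  simp only [Function.comp_apply]
  field_simp
  ring

/-- The two variations differ by the factor h^(2(H - Hn)) = exp(2 (log h) (H - Hn)), and log h is of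
order n. This is the origin of the extra n in the final rate. -/
theorem scaledQVn_est_sub_isBigO (hT : 0 < T) (hκ : 0 < κ) {Hn : ℕ → ℝ}
    (hH : (fun n => H - Hn n) =O[atTop] fun n : ℕ => (2 : ℝ) ^ (-(κ * n))) {x : ℝ → ℝ} {Q : ℝ}
    (hQ : Tendsto (fun n => scaledQVn T (1 - 2 * H) n x) atTop (𝓝 Q)) :
    (fun n => scaledQVn T (1 - 2 * Hn n) n x - scaledQVn T (1 - 2 * H) n x) =O[atTop]
      fun n : ℕ => (n : ℝ) * (2 : ℝ) ^ (-(κ * n)) := by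
  have hlog : (fun n : ℕ => 2 * Real.log (T / 2 ^ n)) =O[atTop] fun n : ℕ => (n : ℝ) := by
    refine Asymptotics.IsBigO.of_bound (2 * (|Real.log T| + Real.log 2)) ?_
    filter_upwards [eventually_ge_atTop 1] with n hn
    have hn1 : (1 : ℝ) ≤ n := by exact_mod_cast hn
    have hl2 : 0 < Real.log 2 := Real.log_pos (by norm_num)
    rw [Real.log_div hT.ne' (by positivity), Real.log_pow, Real.norm_eq_abs, Real.norm_eq_abs,
      abs_mul, abs_of_pos (two_pos : (0 : ℝ) < 2), abs_of_pos (by linarith : (0 : ℝ) < n)]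
    have h1 := abs_sub (Real.log T) (n * Real.log 2)
    rw [abs_of_pos (by positivity : 0 < n * Real.log 2)] at h1
    nlinarith [abs_nonneg (Real.log T)]
  have hexp := exp_sub_one_isBigO (tendsto_mul_two_rpow_neg_mul hκ) (hlog.mul hH)
  have := hexp.mul (hQ.isBigO_one ℝ)
  refine this.congr (fun n => ?_) fun n => mul_one _
  have hh : 0 < T / 2 ^ n := by positivity
  have e : Real.exp (2 * Real.log (T / 2 ^ n) * (H - Hn n)) = (T / 2 ^ n) ^ (2 * (H - Hn n)) := by
    rw [Real.rpow_def_of_pos hh]; congr 1; ring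
  rw [e, scaledQVn_eq, scaledQVn_eq, sub_mul, one_mul, ← mul_assoc, ← Real.rpow_add hh]
  congr 3
  ring

theorem act_smul (c : ℝ) (σ : E d → E d) (f : E d → ℝ) (x : E d) :
    act (fun x => c • σ x) f x = c * act σ f x := by
  simp [act]

theorem act_proj (σ : E d → E d) (j : Fin d) (x : E d) :
    act σ (fun z : E d => z j) x = σ x j := by
  have : (fun z : E d => z j) = EuclideanSpace.proj (𝕜 := ℝ) j := rfl
  rw [act, this, ContinuousLinearMap.fderiv]
  rfl

theorem contDiff_coord (j : Fin d) : ContDiff ℝ 2 (fun z : E d => z j) :=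
  (EuclideanSpace.proj j : E d →L[ℝ] ℝ).contDiff

/-- If the velocity fields vanish along `y` almost everywhere, so do all derivatives along them. -/
theorem integral_act_sq_eq_zero (hT : 0 < T) {σ : E d → E d} {f : E d → ℝ} {y : ℝ → E d}
    (hint : ∀ j, IntervalIntegrable (fun t => act σ (fun z : E d => z j) (y t) ^ 2) volume 0 T)
    (h : ∀ j, ∫ t in (0 : ℝ)..T, act σ (fun z : E d => z j) (y t) ^ 2 = 0) :
    ∫ t in (0 : ℝ)..T, act σ f (y t) ^ 2 = 0 := by
  have hae (j : Fin d) : (fun t => act σ (fun z : E d => z j) (y t) ^ 2)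
      =ᵐ[volume.restrict (Ioc 0 T)] 0 :=
    (intervalIntegral.integral_eq_zero_iff_of_le_of_nonneg_ae hT.le
      (ae_of_all _ fun t => sq_nonneg _) (hint j)).1 (h j)
  rw [intervalIntegral.integral_of_le hT.le]
  refine integral_eq_zero_of_ae ?_
  filter_upwards [ae_all_iff.2 hae] with t ht
  have : σ (y t) = 0 := by
    ext j
    have := ht j
    rw [act_proj] at this
    simpa using this
  simp [act, this]

/-- Convergence of the least squares estimator along a single realisation. -/
theorem leastSquares_estimator_isBigO {a : ℝ} (hT : 0 < T) (hκ0 : 0 < κ) (ha : 0 < a) (ha1 : a ≤ 1)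
    (hκ : κ ≤ a + min (2 * a) 1 - 2 * H) (hκa : κ ≤ a)
    {b : ℝ → E K} (hb : TwoParamHolder T a (fun s t => b t - b s)) (hqv : HasQVRate T H κ a b)
    {u : ℝ → E d → E d} (hu : ContinuousOn (fun p : ℝ × E d => u p.1 p.2) (Icc 0 T ×ˢ univ))
    {σ : Fin K → E d → E d} (hσ : ∀ k, ContDiff ℝ 1 (σ k)) {θ : Fin K → ℝ} {y : ℝ → E d}
    (hy : TwoParamHolder T a (fun s t => y t - y s))
    (hsharp : TwoParamHolder T (2 * a) (fun s t =>
      y t - y s - (∫ r in s..t, u r (y r)) - ∑ k, (b t k - b s k) • (θ k • σ k (y s))))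
    {f : Fin M → E d → ℝ} (hf : ∀ m, ContDiff ℝ 2 (f m))
    (hX : LinearIndependent ℝ (design T σ f y).col) (hY : obsVec T H f y ≠ 0) {βbar : ℕ → E K}
    (hβ : ∀ n, IsLeastSquares (designN T σ f y n) (obsVecEst T f y n) (βbar n)) :
    (fun n => (WithLp.toLp 2 fun k => θ k ^ 2 : E K) - βbar n) =O[atTop]
      fun n : ℕ => (n : ℝ) * (2 : ℝ) ^ (-(κ * n)) := by
  have hac : a ≤ min (2 * a) 1 := le_min (by linarith) ha1
  have hact {φ : E d → ℝ} (hφ : ContDiff ℝ 2 φ) (k : Fin K) :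
      TwoParamHolder T a (fun s t => act (σ k) φ (y t) - act (σ k) φ (y s)) :=
    hy.comp_contDiff ha.le (contDiff_act (hσ k) hφ)
  have hact2 {φ : E d → ℝ} (hφ : ContDiff ℝ 2 φ) (k : Fin K) :
      TwoParamHolder T a (fun s t => act (σ k) φ (y t) ^ 2 - act (σ k) φ (y s) ^ 2) :=
    ((hact hφ k).mul ha.le (hact hφ k)).congr fun s t _ _ _ => by ring
  have hcontrol {φ : E d → ℝ} (hφ : ContDiff ℝ 2 φ) : TwoParamHolder T (min (2 * a) 1) (fun s t =>
      φ (y t) - φ (y s) - ∑ k, (θ k * act (σ k) φ (y s)) * (b t k - b s k)) := by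
    have := TwoParamHolder.comp_solution ha hu (V := fun k x => θ k • σ k x) hy hsharp hφ
    simpa only [act_smul] using this
  have hint {φ : E d → ℝ} (hφ : ContDiff ℝ 2 φ) : (fun n => scaledQVn T (1 - 2 * H) n
      (fun t => φ (y t)) - ∑ k, θ k ^ 2 * ∫ t in (0 : ℝ)..T, act (σ k) φ (y t) ^ 2) =O[atTop]
      fun n : ℕ => (2 : ℝ) ^ (-(κ * n)) := by
    have := scaledQVn_sub_integral_isBigO hT ha hac hκ hκa hb hqv
      (fun k => (hact hφ k).const_mul (θ k)) (hcontrol hφ)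
    simpa only [mul_pow, intervalIntegral.integral_const_mul] using this
  have hlim {φ : E d → ℝ} (hφ : ContDiff ℝ 2 φ) : Tendsto (fun n => scaledQVn T (1 - 2 * H) n
      (fun t => φ (y t))) atTop
      (𝓝 (∑ k, θ k ^ 2 * ∫ t in (0 : ℝ)..T, act (σ k) φ (y t) ^ 2)) := by
    have := ((hint hφ).trans_tendsto (tendsto_two_rpow_neg_mul hκ0)).add_const
      (∑ k, θ k ^ 2 * ∫ t in (0 : ℝ)..T, act (σ k) φ (y t) ^ 2)
    simpa using this
  have hnn (φ : E d → ℝ) (k : Fin K) : 0 ≤ θ k ^ 2 * ∫ t in (0 : ℝ)..T, act (σ k) φ (y t) ^ 2 :=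
    mul_nonneg (sq_nonneg _) (intervalIntegral.integral_nonneg hT.le fun t _ => sq_nonneg _)
  -- The Hurst estimator needs a nondegenerate limit. Were it zero, every σ_k with θ_k ≠ 0 would
  -- vanish along y almost everywhere, and all observations would be zero.
  have hQ : 0 < ∑ j, ∑ k, θ k ^ 2 *
      ∫ t in (0 : ℝ)..T, act (σ k) (fun z : E d => z j) (y t) ^ 2 := by
    refine lt_of_le_of_ne (Finset.sum_nonneg fun j _ => Finset.sum_nonneg fun k _ => hnn _ k)
      fun h0 => hY ?_
    have hz := (Finset.sum_eq_zero_iff_of_nonneg fun j _ =>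
      Finset.sum_nonneg fun k _ => hnn (fun z : E d => z j) k).1 h0.symm
    ext m
    refine (hlim (hf m)).limUnder_eq.trans (Finset.sum_eq_zero fun k _ => ?_)
    by_cases hθ : θ k = 0
    · simp [hθ]
    rw [integral_act_sq_eq_zero hT (fun j => ?_) fun j => ?_, mul_zero]
    · refine ContinuousOn.intervalIntegrable ?_
      rw [uIcc_of_le hT.le]
      exact (hact2 (contDiff_coord j) k).continuousOn ha
    · have := (Finset.sum_eq_zero_iff_of_nonneg fun k _ => hnn (fun z : E d => z j) k).1
        (hz j (Finset.mem_univ j)) k (Finset.mem_univ k)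
      exact (mul_eq_zero.1 this).resolve_left (pow_ne_zero 2 hθ)
  have hvec : (fun n => scaledQVnVec T (1 - 2 * H) n y - ∑ j, ∑ k, θ k ^ 2 *
      ∫ t in (0 : ℝ)..T, act (σ k) (fun z : E d => z j) (y t) ^ 2) =O[atTop]
      fun n : ℕ => (2 : ℝ) ^ (-(κ * n)) := by
    refine (Asymptotics.IsBigO.fun_sum fun j (_ : j ∈ Finset.univ) =>
      hint (contDiff_coord j)).congr_left fun n => ?_
    rw [Finset.sum_sub_distrib]
    rfl
  have hhurst := hurstEst_sub_isBigO hT hκ0 hQ hvec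
  have hdom : (fun n : ℕ => (2 : ℝ) ^ (-(κ * n))) =O[atTop]
      fun n : ℕ => (n : ℝ) * (2 : ℝ) ^ (-(κ * n)) := by
    refine Asymptotics.IsBigO.of_bound 1 ?_
    filter_upwards [eventually_ge_atTop 1] with n hn
    rw [one_mul, norm_mul]
    refine le_mul_of_one_le_left (norm_nonneg _) ?_
    simpa using hn
  refine leastSquares_sub_isBigO hX (fun m k => ?_) (fun m => ?_) hβ
  · have := ((riemannSum_sub_integral_isBigO hT ha (hact2 (hf m) k)).trans_tendsto
      (tendsto_two_rpow_neg_mul ha)).add_const (∫ t in (0 : ℝ)..T, act (σ k) (f m) (y t) ^ 2)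
    simpa [designN, design, dyadic_succ_sub] using this
  -- The observations are compared with the Riemann sums in the perturbed design itself, so only
  -- convergence of the design, without a rate, was needed above.
  · have h1 := scaledQVn_est_sub_isBigO hT hκ0 hhurst (hlim (hf m))
    have h2 := (scaledQVn_sub_riemannSum_isBigO hT ha hac hκ hb hqv
      (fun k => (hact (hf m) k).const_mul (θ k)) (hcontrol (hf m))).trans hdom
    refine (h1.add h2).congr_left fun n => ?_
    simp only [obsVecEst, designN, Matrix.of_apply, dyadic_succ_sub, Finset.sum_mul]
    rw [sub_add_sub_cancel]
    congr 1
    refine Finset.sum_congr rfl fun k _ => Finset.sum_congr rfl fun i _ => by ring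

end Estimators

/-- Since `ε > 0` is arbitrary, the random constant in the rate obtained for a smaller `ε` is absorbed
for large `n`, so that the bounds hold with every positive constant in place of `C₁`. -/
theorem mainTheorem9 {d K M : ℕ} (H : ℝ) (hH : 1 / 3 < H) (hH1 : H < 1) (ε : ℝ) (hε : 0 < ε) :
    -- the constant, a function of `T`, `κ(X)`, `‖B‖_{H-ε}`, `(‖f_m(y)'‖_{H-ε})_m`,
    -- `([f_m(y)^♯]_{2(H-ε)})_m` and `([σ_k[f_m]²(y)]_{H-ε})_{m,k}`
    ∃ C₁ : ℝ → ℝ → ℝ≥0∞ → (Fin M → ℝ≥0∞) → (Fin M → ℝ≥0∞) → (Fin M → Fin K → ℝ≥0∞) → ℝ,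
    ∀ (T : ℝ) (_hT : 0 < T)
      (Ω : Type*) [MeasurableSpace Ω] (P : Measure Ω) [IsProbabilityMeasure P]
      -- the fractional Brownian motion and its rough path lift
      (B : ℝ → Ω → E K) (_hB : IsFBM P H B)
      (BB : Ω → ℝ → ℝ → Matrix (Fin K) (Fin K) ℝ)
      (_hBB : ∀ᵐ ω ∂P, ∀ α : ℝ, 1 / 3 < α → α < H → (1 / 2 < H → 1 / 2 < α) →
        IsRoughPath T α (fun t => B t ω) (BB ω))
      -- the coefficients and the parameter
      (u : ℝ → E d → E d)
      (_hu : ContinuousOn (fun p : ℝ × E d => u p.1 p.2) (Icc 0 T ×ˢ univ))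
      (σ : Fin K → E d → E d)
      (_hσ : ∀ k, ContDiff ℝ (if H ≤ 1 / 2 then 2 else 1) (σ k))
      (θ : Fin K → ℝ) (_hθ : ∀ k, 0 ≤ θ k)
      -- the pathwise solution
      (y : Ω → ℝ → E d)
      (_hy : ∀ᵐ ω ∂P, ∀ α : ℝ, 1 / 3 < α → α < H → (1 / 2 < H → 1 / 2 < α) →
        IsRDESolution T α (fun t => B t ω) (BB ω) u (fun k x => θ k • σ k x) (y ω))
      -- the test functions
      (f : Fin M → E d → ℝ) (_hf : ∀ m, ContDiff ℝ 2 (f m))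
      (_hX : ∀ᵐ ω ∂P, LinearIndependent ℝ (design T σ f (y ω)).col)
      (_hY : ∀ᵐ ω ∂P, obsVec T H f (y ω) ≠ 0),
      ∀ᵐ ω ∂P,
        let V : Fin K → E d → E d := fun k x => θ k • σ k x
        let β : E K := WithLp.toLp 2 fun k => θ k ^ 2
        let C : ℝ := C₁ T (condNumber (design T σ f (y ω)))
          (holderNorm T (H - ε) (fun t => B t ω))
          (fun m => holderNorm T (H - ε) (gubDeriv V (f m) (y ω)))
          (fun m => holderSemi₂ T (2 * (H - ε)) (gubRem (fun t => B t ω) V (f m) (y ω)))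
          (fun m k => holderSemi T (H - ε) (fun t => act (σ k) (f m) (y ω t) ^ 2))
        ∀ βbar : ℕ → E K,
          (∀ n, IsLeastSquares (designN T σ f (y ω) n) (obsVecEst T f (y ω) n) (βbar n)) →
          (∀ᶠ n : ℕ in atTop, ‖β - βbar n‖ ≤ C * (n * rate H n ^ (H - ε))) ∧
          ∀ k, 0 < β k → ∀ᶠ n : ℕ in atTop,
            |θ k - √(βbar n k)| ≤ max C (β k)⁻¹ * (n * rate H n ^ (H - ε)) := by
  obtain ⟨κ, a, δ, hκ0, hκH, ha3, haH, ha2, hκr, hκ, hδε, hδH, hδκ⟩ := exists_exponents hH hH1 hε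
  have ha : 0 < a := by linarith
  have hr := fluctExp_le_half H
  -- Any positive constant would do, the error being little-o of the rate.
  refine ⟨fun _ _ _ _ _ _ => 1, ?_⟩
  intro T hT Ω _ P _ B hB BB hBB u hu σ hσ θ hθ y hy f hf hX hY
  have hσ1 (k : Fin K) : ContDiff ℝ 1 (σ k) := (hσ k).of_le (by split_ifs <;> norm_num)
  filter_upwards [hB.ae_hasQVRate hT (by linarith) hH1 ha hκ0.le hκr hκH, hBB, hy, hX, hY]
    with ω hqv hBBω hyω hXω hYω
  intro β C βbar hβ
  have hBa := hBBω a ha3 haH ha2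
  have hya := hyω a ha3 haH ha2
  have hO : (fun n => β - βbar n) =O[atTop] fun n : ℕ => (n : ℝ) * (2 : ℝ) ^ (-(κ * n)) :=
    leastSquares_estimator_isBigO hT hκ0 ha (by linarith) hκ (by nlinarith)
      (.of_holderSemi₂_lt_top ha.ne' hBa.holder) hqv hu hσ1
      (.of_holderSemi₂_lt_top ha.ne' hya.holder)
      (.of_holderSemi₂_lt_top (by positivity) hya.sharp) hf hXω hYω hβ
  have ho := hO.trans_isLittleO (isLittleO_rate hH1 hδε hδH hδκ)
  have hbound {c : ℝ} (hc : 0 < c) :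
      ∀ᶠ n : ℕ in atTop, ‖β - βbar n‖ ≤ c * (n * rate H n ^ (H - ε)) := by
    filter_upwards [ho.bound hc] with n hn
    have h0 : 0 ≤ rate H n := by rw [rate_eq]; positivity
    rwa [Real.norm_of_nonneg (mul_nonneg n.cast_nonneg (Real.rpow_nonneg h0 _))] at hn
  refine ⟨hbound one_pos, fun k hk => ?_⟩
  have hθk : 0 < θ k := lt_of_le_of_ne (hθ k) fun h0 => by
    have : β k = θ k ^ 2 := rfl
    rw [this, ← h0] at hk
    norm_num at hk
  -- Taking the constant θ_k here cancels the factor θ_k⁻¹ from the square root, leaving 1 = C.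
  filter_upwards [hbound hθk] with n hn
  have h0 : 0 ≤ rate H n := by rw [rate_eq]; positivity
  have h1 : |θ k ^ 2 - βbar n k| ≤ ‖β - βbar n‖ := PiLp.norm_apply_le (β - βbar n) k
  calc |θ k - √(βbar n k)| ≤ (θ k)⁻¹ * |θ k ^ 2 - βbar n k| := abs_sqrt_sub_le hθk
    _ ≤ (θ k)⁻¹ * (θ k * (n * rate H n ^ (H - ε))) := by
        gcongr
        exact h1.trans hn
    _ = 1 * (n * rate H n ^ (H - ε)) := by field_simp
    _ ≤ max C (β k)⁻¹ * (n * rate H n ^ (H - ε)) :=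
        mul_le_mul_of_nonneg_right (le_max_left C _)
          (mul_nonneg n.cast_nonneg (Real.rpow_nonneg h0 _))
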